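/- Let $q=p^h$ with $p$ prime, let $m>1$ be a divisor of $n$, let $k$ be a positive integer with $\gcd(k,n)=1$, and write $x^{[j]}=x^{q^j}$ for $j\in\mathbb Z$ (exponents $j$ are read modulo $n$ for $x\in\mathbb F_{q^n}$). Set $r=n/m$. Let $t\in\{1,\dots,m-2\}$, let $s$ be an integer with $s\not\equiv 0,\pm1,\pm2\pmod m$, and let $\mu\in\mathbb F_{q^n}$ with $\mathrm N_{q^n/q}(\mu)\ne(-1)^{nt}$. *Forms and code.* Let $V=\mathbb F_{q^m}\subseteq V'=\mathbb F_{q^n}$, regarded as $\mathbb F_q$-spaces through their $k$-cyclic models: $x$ stands for $(x,x^{[k]},\dots,x^{[k(m-1)]})$, respectively $(x,x^{[k]},\dots,x^{[k(n-1)]})$. Let $\Omega_{m,n}$ be the space of $\mathbb F_q$-bilinear forms on $V\times V'$; the rank of $f$ is the codimension in $V$ of its left radical. For $c\in\mathbb F_{q^n}$ put $f_{c,j}(x,x')=\mathrm{Tr}_{q^n/q}(c\,x\,x'^{[kj]})$ and $\Omega_j=\{f_{c,j}:c\in\mathbb F_{q^n}\}$. The code $\mathcal H=\mathcal H^{(k)}_{m,n,t,\mu,s}$,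 obtained by restricting to $V\times V'$ the forms of the generalized twisted Gabidulin code on $V'\times V'$, is $$\mathcal H=\{f_{c,0}+f_{\mu c^{[sk]},t}:c\in\mathbb F_{q^n}\}\oplus\Omega_1\oplus\dots\oplus\Omega_{t-1}.$$ *Groups.* $\mathrm{Aut}(\Omega_{m,n})$ is the group of all invertible semilinear transformations of $\Omega_{m,n}$ that preserve the rank, and $\mathrm{Aut}(\mathcal H)$ is the subgroup of those $\tau$ with $\tau(\mathcal H)=\mathcal H$; if $m=n$, only the elements of $(\mathrm{GL}(V)\times\mathrm{GL}(V'))\rtimes\mathrm{Aut}(\mathbb F_q)$ are taken, i.e. those of the form $f\mapsto\big((v,v')\mapsto f(g v,g'v')^{\sigma}\big)$ with $\sigma\in\mathrm{Aut}(\mathbb F_q)$ and $g,g'$ bijective and $\sigma^{-1}$-semilinear (no interchange of the two arguments). A pair $(A,B)\in\mathrm{GL}(V)\times\mathrm{GL}(V')$ acts by $f\mapsto f(A\,\cdot,B\,\cdot)$. For an array $\mathbf b=(b_0,b_1,\dots)$ the $q^k$-circulant matrix $D_{\mathbf b}=\big(b_{j-i}^{[ki]}\big)_{i,j}$ (lower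 indices cyclic) represents, in the $k$-cyclic model, the map $x\mapsto\sum_j b_jx^{[kj]}$. Let $S\le\mathrm{GL}(V)$ be the Singer group of all $D_{\mathbf a}$ with $\mathbf a=(a,0,\dots,0)$, $a\in\mathbb F_{q^m}^*$; let $T'\le\mathrm{GL}(V')$ be the group of all invertible $D_{\mathbf b}$ with $\mathbf b$ an array over $\mathbb F_{q^n}$ whose entries vanish outside the positions $lm$, $0\le l\le r-1$; let $C=\langle\ell\rangle$, where $\ell$ is the pair of cyclic shifts, $\ell(f)(x,x')=f(x^{[-k]},x'^{[-k]})$, so that $\ell(f_{c,j})=f_{c^{[k]},j}$; and let $\mathrm{Aut}(\mathbb F_q)$ act through the powers of $\phi$, $\phi(f)(x,x')=f(x^{1/p},x'^{1/p})^p$, so that $\phi(f_{c,j})=f_{c^p,j}$. The triple $((D_{\mathbf a},D_{\mathbf b});\ell^i;p^e)$ denotes the transformation that applies first $\ell^i$, then $\phi^e$, then $(D_{\mathbf a},D_{\mathbf b})$. Let $G=(S\times T')\,C\,\mathrm{Aut}(\mathbb F_q)$ be the group generated by $S$, $T'$, $\ell$ and $\phi$. **Theorem.** 1. The elements of $G$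 are exactly the triples $((D_{\mathbf a},D_{\mathbf b});\ell^i;p^e)$ with $D_{\mathbf a}\in S$, $D_{\mathbf b}\in T'$, $0\le i<m$, $0\le e<h$. 2. $\mathrm{Aut}(\mathcal H)$ is contained in $G$. 3. For all $D_{\mathbf a}\in S$ with $\mathbf a=(a,0,\dots,0)$, all $D_{\mathbf b}\in T'$, and all integers $i$ and $e\ge 0$, the triple $((D_{\mathbf a},D_{\mathbf b});\ell^i;p^e)$ belongs to $\mathrm{Aut}(\mathcal H)$ if and only if $$\mu\,a^{q^{sk}-1}\,b_{lm}^{(q^{sk}-q^{tk})q^{-klm}}=\mu^{p^eq^{k(i-lm)}}$$ for every $l\in\{0,\dots,r-1\}$ with $b_{lm}\ne0$. -/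

import Mathlib

noncomputable section

namespace PuncturedCodes

/-! ## Bilinear forms, the rank metric and automorphisms -/

section Forms

variable (K V V' : Type*) [Field K] [AddCommGroup V] [Module K V] [AddCommGroup V'] [Module K V']

/-- The `K`-vector space of all bilinear forms on `V × V'`. -/
abbrev Forms := V →ₗ[K] V' →ₗ[K] K

variable {K V V'}

/-- The rank of a form: the codimension in `V` of its left radical
`{v | f v v' = 0 for all v'}`, which is the kernel of `f` seen as a map `V → Hom(V', K)`. -/
def rank (f : Forms K V V') : ℕ :=
  Module.finrank K V - Module.finrank K (LinearMap.ker f)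

/-- A bijection of the space of forms is a semilinear transformation if it is additive and
compatible with the scalars up to some field automorphism of `K`. -/
def IsSemilinear (τ : Equiv.Perm (Forms K V V')) : Prop :=
  (∀ f₁ f₂, τ (f₁ + f₂) = τ f₁ + τ f₂) ∧
    ∃ σ : K ≃+* K, ∀ (c : K) (f : Forms K V V'), τ (c • f) = σ c • τ f

variable (K V V') in
/-- The automorphism group of the rank metric space of forms: all invertible semilinear
transformations that preserve the rank. -/
def rankAut : Subgroup (Equiv.Perm (Forms K V V')) where
  carrier := {τ | IsSemilinear τ ∧ ∀ f, rank (τ f) = rank f}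
  one_mem' := ⟨⟨fun _ _ => rfl, RingEquiv.refl K, fun _ _ => rfl⟩, fun _ => rfl⟩
  mul_mem' := by
    rintro τ υ ⟨⟨hτa, σ, hσ⟩, hτ⟩ ⟨⟨hυa, ρ, hρ⟩, hυ⟩
    refine ⟨⟨fun f₁ f₂ => ?_, ρ.trans σ, fun c f => ?_⟩, fun f => ?_⟩
    · simp [Equiv.Perm.mul_apply, hτa, hυa]
    · simp [Equiv.Perm.mul_apply, hρ, hσ]
    · simp [Equiv.Perm.mul_apply, hτ, hυ]
  inv_mem' := by
    rintro τ ⟨⟨hτa, σ, hσ⟩, hτ⟩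
    have hinv : ∀ f, τ (τ⁻¹ f) = f := τ.apply_symm_apply
    refine ⟨⟨fun f₁ f₂ => ?_, σ.symm, fun c f => ?_⟩, fun f => ?_⟩
    · apply τ.injective
      rw [hτa]
      simp only [hinv]
    · apply τ.injective
      rw [hσ]
      simp only [hinv, RingEquiv.apply_symm_apply]
    · rw [← hτ (τ⁻¹ f), hinv]

/-- The automorphism group of a set `X` of forms: the automorphisms `τ` of the rank metric space
with `τ(X) = X`. -/
def codeAut (X : Set (Forms K V V')) : Subgroup (Equiv.Perm (Forms K V V')) where
  carrier := {τ | τ ∈ rankAut K V V' ∧ τ '' X = X}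
  one_mem' := ⟨one_mem _, by simp⟩
  mul_mem' := by
    rintro τ υ ⟨hτ, hτX⟩ ⟨hυ, hυX⟩
    refine ⟨mul_mem hτ hυ, ?_⟩
    rw [Equiv.Perm.coe_mul, Set.image_comp, hυX, hτX]
  inv_mem' := by
    rintro τ ⟨hτ, hτX⟩
    refine ⟨inv_mem hτ, ?_⟩
    conv_lhs => rw [← hτX]
    rw [← Set.image_comp, ← Equiv.Perm.coe_mul, inv_mul_cancel]
    simp

/-- For a field automorphism `σ` of `K` and additive maps `g`, `g'` that are semilinear with
respect to `σ⁻¹`, the form `(v, v') ↦ σ (f (g v) (g' v'))`. -/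
def semiPullForm (σ : K ≃+* K) (g : V ≃+ V) (g' : V' ≃+ V')
    (hg : ∀ (c : K) v, g (c • v) = σ.symm c • g v)
    (hg' : ∀ (c : K) v, g' (c • v) = σ.symm c • g' v)
    (f : Forms K V V') : Forms K V V' :=
  LinearMap.mk₂ K (fun v v' => σ (f (g v) (g' v')))
    (by intros; simp) (by intros; simp [hg]) (by intros; simp) (by intros; simp [hg'])

/-- The semilinear automorphism `f ↦ ((v, v') ↦ σ (f (g v) (g' v')))` of the space of forms. -/
def semiPull (σ : K ≃+* K) (g : V ≃+ V) (g' : V' ≃+ V')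
    (hg : ∀ (c : K) v, g (c • v) = σ.symm c • g v)
    (hg' : ∀ (c : K) v, g' (c • v) = σ.symm c • g' v) : Equiv.Perm (Forms K V V') where
  toFun := semiPullForm σ g g' hg hg'
  invFun := semiPullForm σ.symm g.symm g'.symm
    (by intro c v; apply g.injective; simp [hg])
    (by intro c v; apply g'.injective; simp [hg'])
  left_inv f := by ext; simp [semiPullForm]
  right_inv f := by ext; simp [semiPullForm]

/-- The linear automorphism `f ↦ ((v, v') ↦ f (g v) (g' v'))` given by
`(g, g') ∈ GL(V) × GL(V')`. -/
def pull (g : V ≃ₗ[K] V) (g' : V' ≃ₗ[K] V') : Equiv.Perm (Forms K V V') :=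
  semiPull (RingEquiv.refl K) g.toAddEquiv g'.toAddEquiv
    (fun c v => g.map_smul c v) (fun c v => g'.map_smul c v)

/-- `τ` lies in `(GL(V) × GL(V')) ⋊ Aut(K)`, that is, `τ` does not interchange the two
arguments of the forms (such an interchange is possible only if `dim V = dim V'`). -/
def NoTransposition (τ : Equiv.Perm (Forms K V V')) : Prop :=
  ∃ (σ : K ≃+* K) (g : V ≃+ V) (g' : V' ≃+ V')
    (hg : ∀ (c : K) v, g (c • v) = σ.symm c • g v)
    (hg' : ∀ (c : K) v, g' (c • v) = σ.symm c • g' v), τ = semiPull σ g g' hg hg'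

end Forms

/-! ## Cyclic models -/

section Cyclic

variable (K : Type*) [Field K] [Fintype K]
variable {F : Type*} [Field F] [Finite F] [Algebra K F]

/-- `fr K j x = x^{[j]} = x^(q^j)`, where `q = |K|`, for any integer `j`: the `j`-th power of the
Frobenius automorphism `x ↦ x^q` of the finite extension `F` of `K`. -/
def fr (j : ℤ) : F ≃ₐ[K] F := FiniteField.frobeniusAlgEquivOfAlgebraic K F ^ j

/-- The vector `(x, x^{[k]}, …, x^{[k(r-1)]})` of the `k`-cyclic model of an `r`-dimensional
vector space over `K`, where `r = [F : K]`. The model is identified with `F` through `x`. -/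
def cyc (k : ℕ) (x : F) : Fin (Module.finrank K F) → F :=
  fun i => fr K ((k : ℤ) * (i : ℕ)) x

/-- The `r × r` `q^k`-circulant matrix generated by the array `a`: its `(i, j)`-entry is
`a_{j - i}^{[ki]}`, with indices modulo `r = [F : K]`. -/
def circulant (k : ℕ) (a : Fin (Module.finrank K F) → F) :
    Matrix (Fin (Module.finrank K F)) (Fin (Module.finrank K F)) F :=
  Matrix.of fun i j => fr K ((k : ℤ) * (i : ℕ)) (a (j - i))

/-- The `q^k`-circulant matrix generated by `a` is the matrix of the element `g` of the general
linear group in the `k`-cyclic model. -/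
def IsMatrixOf (k : ℕ) (a : Fin (Module.finrank K F) → F) (g : F ≃ₗ[K] F) : Prop :=
  ∀ x : F, (circulant K k a).mulVec (cyc K k x) = cyc K k (g x)

/-- The array `(a, 0, …, 0)`. -/
def singleArray (a : F) : Fin (Module.finrank K F) → F :=
  fun j => if (j : ℕ) = 0 then a else 0

end Cyclic

/-! ## Punctured generalized twisted Gabidulin codes

`K = 𝔽_q`, `L = 𝔽_{q^m}`, `M = 𝔽_{q^n}`. In the `k`-cyclic models, `L` is `V`, `M` is `V'`. -/

section Codes

variable (K L M : Type*) [Field K] [Fintype K] [Field L] [Finite L] [Field M] [Finite M]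
  [Algebra K L] [Algebra K M] [Algebra L M] [IsScalarTower K L M]

/-- The form `f_{c,j}^{(k)}(x, x') = Tr(c x x'^{[kj]})` on `V' × V' = M × M`. -/
def form (k j : ℕ) (c : M) : Forms K M M :=
  LinearMap.mk₂ K (fun x x' => Algebra.trace K M (c * x * fr K ((k : ℤ) * j) x'))
    (by intros; simp [mul_add, add_mul])
    (by intros; simp)
    (by intros; simp [mul_add])
    (by intros; simp)

/-- `c ↦ f_{c,j}^{(k)}` as a linear map; its range is the component `Ω_j^{(k)}`. -/
def formMap (k j : ℕ) : M →ₗ[K] Forms K M M where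
  toFun := form K M k j
  map_add' c d := by ext; simp [form, add_mul]
  map_smul' c d := by ext; simp [form]

/-- The generalized twisted Gabidulin code
`{f_{c,0} + f_{μ c^{[sk]}, t} : c ∈ M} ⊕ Ω_1 ⊕ … ⊕ Ω_{t-1}` in the space of forms on `M × M`. -/
def twistedCode (k t : ℕ) (μ : M) (s : ℤ) : Submodule K (Forms K M M) :=
  LinearMap.range (formMap K M k 0 +
      formMap K M k t ∘ₗ LinearMap.mulLeft K μ ∘ₗ (fr K (s * k) : M ≃ₐ[K] M).toLinearMap) ⊔
    ⨆ j ∈ Finset.Ico 1 t, LinearMap.range (formMap K M k j)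

/-- Puncturing: restriction of a form on `M × M` to `L × M`. -/
def restrictForm : Forms K M M →ₗ[K] Forms K L M :=
  LinearMap.lcomp K (M →ₗ[K] K) (IsScalarTower.toAlgHom K L M).toLinearMap

/-- The code `H_{m,n,t,μ,s}^{(k)}` obtained by puncturing the generalized twisted Gabidulin
code. -/
def puncturedCode (k t : ℕ) (μ : M) (s : ℤ) : Submodule K (Forms K L M) :=
  (twistedCode K M k t μ s).map (restrictForm K L M)

variable {M} in
/-- The array `b = (b_0, …, b_{n-1})` vanishes outside the positions divisible by `m`. -/
def SupportedOnMultiples (b : Fin (Module.finrank K M) → M) : Prop :=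
  ∀ j : Fin (Module.finrank K M), ¬ Module.finrank K L ∣ (j : ℕ) → b j = 0

/-- The generator `ℓ` of the cyclic group `C`: both `V` and `V'` are acted on by the cyclic shift
of the coordinates of the `k`-cyclic model, that is, by `x ↦ x^{[-k]}`. Thus
`f_{c,j} ↦ f_{c^{[k]},j}`. -/
def shift (k : ℕ) : Equiv.Perm (Forms K L M) :=
  pull (fr K (-(k : ℤ)) : L ≃ₐ[K] L).toLinearEquiv (fr K (-(k : ℤ)) : M ≃ₐ[K] M).toLinearEquiv

variable (p : ℕ) [Fact p.Prime] [CharP K p] [CharP L p] [CharP M p]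

/-- The generator `φ` of `Aut(𝔽_q)`: `f ↦ ((x, x') ↦ f(x^{1/p}, x'^{1/p})^p)`. Thus
`f_{c,j} ↦ f_{c^p,j}`. -/
def frobForms : Equiv.Perm (Forms K L M) :=
  semiPull (frobeniusEquiv K p) (frobeniusEquiv L p).symm.toAddEquiv
    (frobeniusEquiv M p).symm.toAddEquiv
    (by
      intro c v
      obtain ⟨d, rfl⟩ := (frobeniusEquiv K p).surjective c
      apply (frobeniusEquiv L p).injective
      simp [Algebra.smul_def, frobenius_def, mul_pow])
    (by
      intro c v
      obtain ⟨d, rfl⟩ := (frobeniusEquiv K p).surjective c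
      apply (frobeniusEquiv M p).injective
      simp [Algebra.smul_def, frobenius_def, mul_pow])

/-- The group `(S × T') C Aut(𝔽_q)`: generated by the Singer cyclic group `S` of `V` (the
circulant matrices of arrays `(a, 0, …, 0)`), by the group `T'` of the elements of `GL(V')` whose
array is supported on the multiples of `m`, by `ℓ`, and by `φ`. -/
def bigGroup (k : ℕ) : Subgroup (Equiv.Perm (Forms K L M)) :=
  Subgroup.closure
    ({τ | ∃ (a : L) (A : L ≃ₗ[K] L), IsMatrixOf K k (singleArray K a) A ∧
        τ = pull A (LinearEquiv.refl K M)} ∪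
     {τ | ∃ (b : Fin (Module.finrank K M) → M) (B : M ≃ₗ[K] M), SupportedOnMultiples K L b ∧
        IsMatrixOf K k b B ∧ τ = pull (LinearEquiv.refl K L) B} ∪
     {shift K L M k} ∪ {frobForms K L M p})

variable {K L M}

/-- `τ` is the automorphism denoted by the triple `((D_a, D_b); ℓ^i; p^e)`, where `a` stands for
`(a, 0, …, 0)` and `b` is supported on the multiples of `m`: first `ℓ^i`, then `φ^e`, then the
pair of elements of `GL(V)` and `GL(V')` with matrices `D_a` and `D_b` are applied. -/
def IsTriple (k : ℕ) (τ : Equiv.Perm (Forms K L M)) (a : L) (b : Fin (Module.finrank K M) → M)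
    (i : ℤ) (e : ℕ) : Prop :=
  SupportedOnMultiples K L b ∧
    ∃ (A : L ≃ₗ[K] L) (B : M ≃ₗ[K] M), IsMatrixOf K k (singleArray K a) A ∧ IsMatrixOf K k b B ∧
      τ = pull A B * frobForms K L M p ^ e * shift K L M k ^ i

end Codes

end PuncturedCodes

end

/-! Write σ for x ↦ x^{[-k]}. The trace form identifies a form on L × M with a K-linear map φ : L →
M. As k is prime to n, φ has a unique expansion ∑_{i<m} c_i σ^i with c_i in M. In these coordinates
the code is given by c_i = 0 for t < i < m and c_t = η σ^{t-s}(c_0), where η = σ^t(μ)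
(`mem_puncturedCode`). A pair (A, B) acts by φ ↦ G φ A, with G the trace adjoint of B.

Containment. An automorphism of the code is a pair times a Frobenius power. For m = n this is
assumed. For m < n it follows from `exists_eq_pull_of_rank_preserving`: forms of rank one are pure
tensors, a linear space of such forms has a common factor, and unequal dimensions forbid exchanging
the two sides. The central claim is `modEq_zero_of_twistedSpace`: if φ ↦ G φ A carries one twisted
space into another, nonzero coefficients of A and G have opposite indices mod m. By `coef_sandwich`,
the conditions imposed on G (d σ^l) A for all d split into conditions on single products of a
coefficient of G and one of A. For t ≥ 2 these nearly suffice by themselves; for t = 1 with a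
nonzero twist only two-term relations remain, and `add_eq_zero_of_relations` settles them by
combinatorics in ℤ/m. Hence A and B are semilinear over L for one and the same power of σ.

The big group. Its elements are exactly the transformations induced by pairs that are semilinear
over L for a common automorphism of L. Each such automorphism is realised by some φ^e ℓ^i with small
exponents (`exists_exponents`). After dividing it out, A is multiplication by some a and B is
L-linear, that is, b is supported on multiples of m. This gives the normal form of triples and
completes the containment.

The criterion. A triple acts on each coefficient separately, c_v ↦ σ^v(a) G((c_v^{[ki]})^{p^e}), so
only the twist condition has to be checked. It is an identity of linear maps in c, and comparing
coefficients gives one equation for each nonzero b_{lm}. -/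

noncomputable section

namespace PuncturedCodes

/-! ### Integer powers of the Frobenius automorphism -/

section Frobenius

variable (K : Type*) [Field K] [Fintype K]
variable {F : Type*} [Field F] [Finite F] [Algebra K F]

theorem fr_zero (x : F) : fr K 0 x = x := by simp [fr]

theorem fr_add (i j : ℤ) (x : F) : fr K (i + j) x = fr K i (fr K j x) := by
  simp [fr, zpow_add, AlgEquiv.mul_apply]

theorem fr_natCast (j : ℕ) (x : F) : fr K (j : ℤ) x = x ^ Fintype.card K ^ j := by
  rw [fr, zpow_natCast, AlgEquiv.coe_pow, FiniteField.coe_frobeniusAlgEquivOfAlgebraic_iterate]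

theorem fr_eq_iff (i j : ℤ) :
    (fr K i : F ≃ₐ[K] F) = fr K j ↔ i ≡ j [ZMOD Module.finrank K F] := by
  rw [fr, fr, zpow_eq_zpow_iff_modEq, FiniteField.orderOf_frobeniusAlgEquivOfAlgebraic]

theorem fr_symm (j : ℤ) : (fr K j : F ≃ₐ[K] F).symm = fr K (-j) := by
  ext x
  rw [AlgEquiv.symm_apply_eq, ← fr_add, add_neg_cancel, fr_zero]

theorem fr_algebraMap {E : Type*} [Field E] [Finite E] [Algebra K E] [Algebra F E]
    [IsScalarTower K F E] (j : ℤ) (x : F) :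
    algebraMap F E (fr K j x) = fr K j (algebraMap F E x) := by
  have hn : ∀ (j : ℕ) (x : F), algebraMap F E (fr K (j : ℤ) x) = fr K j (algebraMap F E x) := by
    intro j x
    rw [fr_natCast, fr_natCast, map_pow]
  obtain ⟨n, rfl | rfl⟩ := j.eq_nat_or_neg
  · exact hn n x
  · apply (fr K (n : ℤ) : E ≃ₐ[K] E).injective
    rw [← hn, ← fr_add, ← fr_add]
    simp [fr_zero]

end Frobenius

/-! ### Expansion of K-linear maps L → M in powers of σ = `fr K (-k)` -/

section Coefficients

theorem modEq_of_modEq_finrank {K L M : Type*} [Field K] [Field L] [Field M] [Algebra K L]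
    [Algebra K M] [Algebra L M] [IsScalarTower K L M] {i j : ℤ}
    (h : i ≡ j [ZMOD Module.finrank K M]) : i ≡ j [ZMOD Module.finrank K L] := by
  refine h.of_dvd ?_
  have := Module.finrank_mul_finrank K L M
  exact_mod_cast Dvd.intro _ this

variable (K : Type*) {L M : Type*} [Field K] [Fintype K] [Field L] [Finite L] [Field M] [Finite M]
  [Algebra K L] [Algebra K M] [Algebra L M] [IsScalarTower K L M]

/-- The map `x ↦ fr K (-k * i) x` of `L` into the extension `M`. -/
def frobMap (L M : Type*) [Field L] [Finite L] [Field M] [Finite M]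
    [Algebra K L] [Algebra K M] [Algebra L M] [IsScalarTower K L M] (k : ℕ) (i : ℤ) :
    L →ₐ[K] M :=
  (IsScalarTower.toAlgHom K L M).comp (fr K (-(k : ℤ) * i) : L ≃ₐ[K] L)

theorem frobMap_apply (k : ℕ) (i : ℤ) (x : L) :
    frobMap K L M k i x = algebraMap L M (fr K (-(k : ℤ) * i) x) := rfl

theorem frobMap_apply' (k : ℕ) (i : ℤ) (x : L) :
    frobMap K L M k i x = fr K (-(k : ℤ) * i) (algebraMap L M x) := by
  rw [frobMap_apply, fr_algebraMap]

theorem modEq_of_neg_mul {m k : ℕ} (hk : Nat.Coprime k m) (i j : ℤ) :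
    -(k : ℤ) * i ≡ -(k : ℤ) * j [ZMOD m] ↔ i ≡ j [ZMOD m] := by
  constructor
  · intro h
    rw [Int.modEq_iff_dvd] at h ⊢
    have h2 : (m : ℤ) ∣ (k : ℤ) * (j - i) := by
      have e : (k : ℤ) * (j - i) = -(-(k : ℤ) * j - -(k : ℤ) * i) := by ring
      rw [e]
      exact dvd_neg.mpr h
    exact IsCoprime.dvd_of_dvd_mul_left (Nat.isCoprime_iff_coprime.mpr hk.symm) h2
  · intro h
    exact h.mul_left _

theorem frobMap_eq_iff {k : ℕ} (hk : Nat.Coprime k (Module.finrank K L)) (i j : ℤ) :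
    frobMap K L M k i = frobMap K L M k j ↔ i ≡ j [ZMOD Module.finrank K L] := by
  rw [← modEq_of_neg_mul hk, ← fr_eq_iff K (F := L)]
  constructor
  · intro h
    ext x
    exact (algebraMap L M).injective (DFunLike.congr_fun h x)
  · intro h
    rw [frobMap, frobMap, h]

theorem frobMap_congr {k : ℕ} {i j : ℤ} (h : i ≡ j [ZMOD Module.finrank K L]) :
    frobMap K L M k i = frobMap K L M k j := by
  rw [frobMap, frobMap, (fr_eq_iff K _ _).mpr (h.mul_left _)]

/-- `c ↦ ∑ i, c i • frobMap K L M k i`. -/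
def sumFrob (L M : Type*) [Field L] [Finite L] [Field M] [Finite M]
    [Algebra K L] [Algebra K M] [Algebra L M] [IsScalarTower K L M] (k : ℕ) :
    (Fin (Module.finrank K L) → M) →ₗ[K] (L →ₗ[K] M) where
  toFun c := ∑ i, c i • (frobMap K L M k (i : ℕ)).toLinearMap
  map_add' c d := by simp [add_smul, Finset.sum_add_distrib]
  map_smul' c d := by simp [Finset.smul_sum, smul_assoc]

theorem sumFrob_apply (k : ℕ) (c : Fin (Module.finrank K L) → M) (x : L) :
    sumFrob K L M k c x = ∑ i, c i * frobMap K L M k (i : ℕ) x := by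
  simp [sumFrob]

/-- Dedekind independence of characters applies, because coprimality makes the `finrank K L` powers
of σ distinct. -/
theorem sumFrob_injective {k : ℕ} (hk : Nat.Coprime k (Module.finrank K L)) :
    Function.Injective (sumFrob K L M k) := by
  rw [← LinearMap.ker_eq_bot, LinearMap.ker_eq_bot']
  intro c hc
  have hinj : Function.Injective
      fun i : Fin (Module.finrank K L) => (frobMap K L M k (i : ℕ) : L →* M) := by
    intro i j hij
    have h1 : frobMap K L M k (i : ℕ) = frobMap K L M k (j : ℕ) := by
      ext x
      exact DFunLike.congr_fun hij x
    have h2 := (frobMap_eq_iff K hk _ _).mp h1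
    rw [Int.natCast_modEq_iff] at h2
    exact Fin.ext (h2.eq_of_lt_of_lt i.2 j.2)
  have hli := (linearIndependent_monoidHom L M).comp _ hinj
  rw [Fintype.linearIndependent_iff] at hli
  funext i
  refine hli c ?_ i
  funext x
  have := LinearMap.congr_fun hc x
  rw [sumFrob_apply] at this
  simpa using this

/-- The coordinates of a `K`-linear map with respect to the powers of `fr K (-k)`. -/
def sumFrobEquiv (M : Type*) [Field M] [Finite M] [Algebra K M] [Algebra L M] [IsScalarTower K L M]
    {k : ℕ} (hk : Nat.Coprime k (Module.finrank K L)) :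
    (Fin (Module.finrank K L) → M) ≃ₗ[K] (L →ₗ[K] M) :=
  LinearEquiv.ofInjectiveOfFinrankEq (sumFrob K L M k) (sumFrob_injective K hk)
    (by rw [Module.finrank_linearMap, Module.finrank_pi_fintype]; simp)

variable {K} in
/-- The coefficient of `fr K (-k * i)` in a `K`-linear map, for any integer `i`. -/
def coef {k : ℕ} (hk : Nat.Coprime k (Module.finrank K L)) (i : ℤ) : (L →ₗ[K] M) →ₗ[K] M :=
  haveI : NeZero (Module.finrank K L) := ⟨Module.finrank_pos.ne'⟩
  LinearMap.proj (Fin.ofNat (Module.finrank K L) (i % Module.finrank K L).toNat) ∘ₗ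
    (sumFrobEquiv K M hk).symm.toLinearMap

variable {K} {k : ℕ} (hk : Nat.Coprime k (Module.finrank K L))

theorem coef_congr {i j : ℤ} (h : i ≡ j [ZMOD Module.finrank K L]) (φ : L →ₗ[K] M) :
    coef hk i φ = coef hk j φ := by
  rw [coef, coef, h]

theorem coef_natCast (i : Fin (Module.finrank K L)) (φ : L →ₗ[K] M) :
    coef hk (i : ℕ) φ = (sumFrobEquiv K M hk).symm φ i := by
  have : NeZero (Module.finrank K L) := ⟨Module.finrank_pos.ne'⟩
  change (sumFrobEquiv K M hk).symm φ (Fin.ofNat (Module.finrank K L) _) = _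
  refine congrArg _ (Fin.ext ?_)
  have h : ((i : ℕ) : ℤ) % (Module.finrank K L : ℤ) = ((i : ℕ) : ℤ) :=
    Int.emod_eq_of_lt (by omega) (by have := i.2; omega)
  rw [h]
  simp

theorem eq_sum_coef (φ : L →ₗ[K] M) (x : L) :
    φ x = ∑ i : Fin (Module.finrank K L), coef hk (i : ℕ) φ * frobMap K L M k (i : ℕ) x := by
  simp only [coef_natCast]
  rw [← sumFrob_apply]
  conv_lhs => rw [← (sumFrobEquiv K M hk).apply_symm_apply φ]
  rfl

/-- Uniqueness of the expansion, in the form used to compute coefficients. Taking c periodic on ℤ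
avoids choosing representatives whenever indices are shifted. -/
theorem coef_eq_of_sum {φ : L →ₗ[K] M} {c : ℤ → M}
    (hc : ∀ i j : ℤ, i ≡ j [ZMOD Module.finrank K L] → c i = c j)
    (h : ∀ x, φ x = ∑ i : Fin (Module.finrank K L), c (i : ℕ) * frobMap K L M k (i : ℕ) x)
    (i : ℤ) : coef hk i φ = c i := by
  have hfin : ∀ i : Fin (Module.finrank K L), coef hk (i : ℕ) φ = c (i : ℕ) := by
    intro i
    rw [coef_natCast]
    have : φ = sumFrobEquiv K M hk fun i => c (i : ℕ) := by
      ext x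
      rw [h]
      exact (sumFrob_apply K k _ x).symm
    rw [this, LinearEquiv.symm_apply_apply]
  have hpos : 0 < (Module.finrank K L : ℤ) := by exact_mod_cast Module.finrank_pos
  have h0 := Int.emod_nonneg i hpos.ne'
  have hlt := Int.emod_lt_of_pos i hpos
  obtain ⟨r, hr⟩ := Int.eq_ofNat_of_zero_le h0
  have hmod : i ≡ (r : ℤ) [ZMOD Module.finrank K L] := by
    rw [← hr]
    exact (Int.mod_modEq _ _).symm
  rw [coef_congr hk hmod, hc _ _ hmod]
  exact hfin ⟨r, by omega⟩

theorem coef_ext {φ ψ : L →ₗ[K] M} (h : ∀ i, coef hk i φ = coef hk i ψ) : φ = ψ := by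
  refine LinearMap.ext fun x => ?_
  rw [eq_sum_coef hk φ, eq_sum_coef hk ψ]
  simp only [h]

/-- Sums over a full period may be shifted. -/
theorem sum_shift_of_periodic {A : Type*} [AddCommMonoid A] {m : ℕ} (hm : 0 < m) (f : ℤ → A)
    (hf : ∀ i j : ℤ, i ≡ j [ZMOD m] → f i = f j) (d : ℤ) :
    ∑ i : Fin m, f ((i : ℕ) + d) = ∑ i : Fin m, f (i : ℕ) := by
  have : NeZero m := ⟨hm.ne'⟩
  set e : ZMod m ≃ Fin m := (ZMod.finEquiv m).symm.toEquiv with he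
  have key : ∀ z : ZMod m, ((((ZMod.finEquiv m).symm z : Fin m) : ℕ) : ZMod m) = z := by
    intro z
    cases m with
    | zero => exact absurd rfl (NeZero.ne 0)
    | succ m => exact Fin.cast_val_eq_self z
  have h1 : ∀ g : ℤ → A, (∀ i j : ℤ, i ≡ j [ZMOD m] → g i = g j) →
      ∑ i : Fin m, g (i : ℕ) = ∑ z : ZMod m, g z.val := by
    intro g hg
    rw [← e.sum_comp]
    refine Finset.sum_congr rfl fun z _ => hg _ _ ?_
    rw [← ZMod.intCast_eq_intCast_iff]
    simp [he, key]
  have h2 := Equiv.sum_comp (Equiv.addRight (d : ZMod m)) (fun z : ZMod m => f (z.val : ℤ))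
  rw [h1 f hf, h1 (fun i => f (i + d)) (fun i j hij => hf _ _ (hij.add_right d)), ← h2]
  refine Finset.sum_congr rfl fun z _ => hf _ _ ?_
  rw [← ZMod.intCast_eq_intCast_iff]
  simp

/-- σ^j (c_i σ^i) = σ^j(c_i) σ^{i+j}, followed by a reindexing of a periodic sum. -/
theorem coef_fr (j i : ℤ) (φ : L →ₗ[K] M) :
    coef hk i ((fr K (-(k : ℤ) * j) : M ≃ₐ[K] M).toLinearMap ∘ₗ φ) =
      fr K (-(k : ℤ) * j) (coef hk (i - j) φ) := by
  apply coef_eq_of_sum hk (c := fun i => fr K (-(k : ℤ) * j) (coef hk (i - j) φ))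
  · intro a b hab
    simp only [coef_congr hk (hab.sub_right j)]
  · intro x
    have h := sum_shift_of_periodic (m := Module.finrank K L) Module.finrank_pos
      (fun i => fr K (-(k : ℤ) * j) (coef hk (i - j) φ) * frobMap K L M k i x)
      (by
        intro a b hab
        simp only [coef_congr hk (hab.sub_right j), frobMap_congr K hab]) j
    rw [← h]
    simp only [LinearMap.comp_apply, AlgEquiv.toLinearMap_apply]
    rw [eq_sum_coef hk φ x, map_sum]
    refine Finset.sum_congr rfl fun i _ => ?_
    rw [map_mul, frobMap_apply', frobMap_apply', ← fr_add, add_sub_cancel_right]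
    congr 3
    ring

theorem coef_comp_mul (y : L) (i : ℤ) (φ : L →ₗ[K] M) :
    coef hk i (φ ∘ₗ LinearMap.mulLeft K y) = coef hk i φ * frobMap K L M k i y := by
  apply coef_eq_of_sum hk (c := fun i => coef hk i φ * frobMap K L M k i y)
  · intro a b hab
    simp only [coef_congr hk hab, frobMap_congr K hab]
  · intro x
    rw [LinearMap.comp_apply, eq_sum_coef hk φ]
    simp [mul_assoc]

theorem coef_mul_comp (c : M) (i : ℤ) (φ : L →ₗ[K] M) :
    coef hk i (LinearMap.mulLeft K c ∘ₗ φ) = c * coef hk i φ := by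
  apply coef_eq_of_sum hk (c := fun i => c * coef hk i φ)
  · intro a b hab
    simp only [coef_congr hk hab]
  · intro x
    rw [LinearMap.comp_apply, eq_sum_coef hk φ]
    simp [mul_assoc]

theorem coef_smul (c : M) (i : ℤ) (φ : L →ₗ[K] M) :
    coef hk i (c • φ) = c * coef hk i φ := by
  rw [← coef_mul_comp]
  congr 1

theorem coef_frobMap (i j : ℤ) :
    coef hk i (frobMap K L M k j).toLinearMap =
      if i ≡ j [ZMOD Module.finrank K L] then 1 else 0 := by
  classical
  apply coef_eq_of_sum hk (c := fun i => if i ≡ j [ZMOD Module.finrank K L] then 1 else 0)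
  · intro a b hab
    have : a ≡ j [ZMOD Module.finrank K L] ↔ b ≡ j [ZMOD Module.finrank K L] :=
      ⟨fun h => hab.symm.trans h, fun h => hab.trans h⟩
    simp only [this]
  · intro x
    have hpos : 0 < (Module.finrank K L : ℤ) := by exact_mod_cast Module.finrank_pos
    have h0 := Int.emod_nonneg j hpos.ne'
    have hlt := Int.emod_lt_of_pos j hpos
    obtain ⟨r, hr⟩ := Int.eq_ofNat_of_zero_le h0
    have hr' : r < Module.finrank K L := by omega
    have hmod : (r : ℤ) ≡ j [ZMOD Module.finrank K L] := by
      rw [← hr]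
      exact Int.mod_modEq _ _
    rw [Finset.sum_eq_single ⟨r, hr'⟩]
    · simp [hmod, frobMap_congr K hmod]
    · intro b _ hb
      rw [if_neg, zero_mul]
      intro h
      have := h.trans hmod.symm
      rw [Int.natCast_modEq_iff] at this
      exact hb (Fin.ext (this.eq_of_lt_of_lt b.2 hr'))
    · simp

end Coefficients

/-! ### Forms as linear maps, and the code as a twisted space -/

section TraceForms

/-- A `K`-linear map `φ : L → M` gives the form `(x, x') ↦ Tr(φ(x) x')`; every form arises in
this way. -/
def toForm (K L M : Type*) [Field K] [Fintype K] [Field L] [Field M] [Finite M]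
    [Algebra K L] [Algebra K M] : (L →ₗ[K] M) ≃ₗ[K] Forms K L M :=
  LinearEquiv.congrRight
    ((Algebra.traceForm K M).toDual (traceForm_nondegenerate K M))

theorem toForm_apply {K L M : Type*} [Field K] [Fintype K] [Field L] [Field M] [Finite M]
    [Algebra K L] [Algebra K M] (φ : L →ₗ[K] M) (x : L) (x' : M) :
    toForm K L M φ x x' = Algebra.trace K M (φ x * x') := rfl

variable {K L M : Type*} [Field K] [Fintype K] [Field L] [Finite L] [Field M] [Finite M]
  [Algebra K L] [Algebra K M] [Algebra L M] [IsScalarTower K L M]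

theorem trace_fr (j : ℤ) (x : M) : Algebra.trace K M (fr K j x) = Algebra.trace K M x :=
  Algebra.trace_eq_of_algEquiv _ _

theorem eq_zero_of_trace_mul {c : M} (h : ∀ x, Algebra.trace K M (c * x) = 0) : c = 0 :=
  (traceForm_nondegenerate K M).1 c h

variable {k : ℕ} (hk : Nat.Coprime k (Module.finrank K L))

theorem coef_algebraMap_comp (i : ℤ) (A : L →ₗ[K] L) :
    coef hk i ((IsScalarTower.toAlgHom K L M).toLinearMap ∘ₗ A) =
      algebraMap L M (coef hk i A) := by
  apply coef_eq_of_sum hk (c := fun i => algebraMap L M (coef hk i A))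
  · intro a b hab
    simp only [coef_congr hk hab]
  · intro x
    rw [LinearMap.comp_apply, eq_sum_coef hk A, map_sum]
    refine Finset.sum_congr rfl fun i _ => ?_
    rw [frobMap_apply, frobMap_apply]
    simp

theorem coef_frobMap_comp (i j : ℤ) (A : L →ₗ[K] L) :
    coef hk i ((frobMap K L M k j).toLinearMap ∘ₗ A) =
      frobMap K L M k j (coef hk (i - j) A) := by
  have h : (frobMap K L M k j).toLinearMap ∘ₗ A =
      (fr K (-(k : ℤ) * j) : M ≃ₐ[K] M).toLinearMap ∘ₗ
        ((IsScalarTower.toAlgHom K L M).toLinearMap ∘ₗ A) := by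
    ext x
    simp [frobMap_apply']
  rw [h, coef_fr, coef_algebraMap_comp, frobMap_apply']

/-- For given `d`, the linear map `x ↦ G (d * A(x)^σ)` with `σ = frobMap K L M k l`. -/
def sandwich (k : ℕ) (G : M →ₗ[K] M) (A : L →ₗ[K] L) (l : ℤ) : M →ₗ[K] (L →ₗ[K] M) :=
  ((LinearMap.mul K M).compr₂ G).compl₂ ((frobMap K L M k l).toLinearMap ∘ₗ A)

theorem sandwich_apply (G : M →ₗ[K] M) (A : L →ₗ[K] L) (l : ℤ) (d : M) (x : L) :
    sandwich k G A l d x = G (d * frobMap K L M k l (A x)) := rfl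

theorem fr_frobMap (i j : ℤ) (x : L) :
    frobMap K M M k i (frobMap K L M k j x) = frobMap K L M k (i + j) x := by
  rw [frobMap_apply', frobMap_apply', frobMap_apply', Algebra.algebraMap_self_apply, ← fr_add]
  congr 2
  ring

theorem frobMap_self_apply (k : ℕ) (i : ℤ) (x : M) :
    frobMap K M M k i x = fr K (-(k : ℤ) * i) x := rfl

/-- G(d σ^l(A x)) is the sum of the terms g_j σ^j(d) σ^{j+l}(a_i) σ^{i+j+l}(x). Fixing the power of
σ at x and then the one at d isolates a single product, so a condition valid for all d decouples. -/
theorem coef_sandwich (hkM : Nat.Coprime k (Module.finrank K M))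
    (G : M →ₗ[K] M) (A : L →ₗ[K] L) (l i j : ℤ) :
    coef hkM j (coef hk i ∘ₗ sandwich k G A l) =
      coef hkM j G * frobMap K L M k (j + l) (coef hk (i - j - l) A) := by
  apply coef_eq_of_sum hkM
    (c := fun j => coef hkM j G * frobMap K L M k (j + l) (coef hk (i - j - l) A))
  · intro a b hab
    -- The index j has period n, while A and the embedding of L only see it modulo m, a divisor of
    -- n.
    have hab' : a ≡ b [ZMOD Module.finrank K L] := modEq_of_modEq_finrank hab
    simp only [coef_congr hkM hab, frobMap_congr K (hab'.add_right l),
      coef_congr hk ((hab'.sub_left i).sub_right l)]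
  · intro d
    have h : sandwich k G A l d = ∑ j : Fin (Module.finrank K M),
        (coef hkM (j : ℕ) G * frobMap K M M k (j : ℕ) d) •
          ((frobMap K L M k ((j : ℕ) + l)).toLinearMap ∘ₗ A) := by
      ext x
      rw [sandwich_apply, eq_sum_coef hkM G]
      simp [fr_frobMap, mul_assoc]
    rw [LinearMap.comp_apply, h, map_sum]
    refine Finset.sum_congr rfl fun j _ => ?_
    rw [coef_smul, coef_frobMap_comp, sub_sub]
    ring

/-- The maps `∑ i ≤ t, c i * σ ^ i` with `c t = η * σ ^ u (c 0)`, where `σ = fr K (-k)`. -/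
def twistedSpace (t : ℕ) (η : M) (u : ℤ) : Submodule K (L →ₗ[K] M) where
  carrier := {φ | (∀ i : ℤ, t < i → i < Module.finrank K L → coef hk i φ = 0) ∧
    coef hk t φ = η * fr K (-(k : ℤ) * u) (coef hk 0 φ)}
  add_mem' := by
    rintro φ ψ ⟨h1, h2⟩ ⟨h3, h4⟩
    refine ⟨fun i hi hi' => ?_, ?_⟩
    · rw [map_add, h1 i hi hi', h3 i hi hi', add_zero]
    · rw [map_add, map_add, map_add, h2, h4, mul_add]
  zero_mem' := ⟨fun i _ _ => map_zero _, by simp⟩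
  smul_mem' := by
    rintro c φ ⟨h1, h2⟩
    refine ⟨fun i hi hi' => ?_, ?_⟩
    · rw [map_smul, h1 i hi hi', smul_zero]
    · rw [map_smul, map_smul, map_smul, h2, mul_smul_comm]

theorem mem_twistedSpace {t : ℕ} {η : M} {u : ℤ} {φ : L →ₗ[K] M} :
    φ ∈ twistedSpace hk t η u ↔
      (∀ i : ℤ, t < i → i < Module.finrank K L → coef hk i φ = 0) ∧
        coef hk t φ = η * fr K (-(k : ℤ) * u) (coef hk 0 φ) := Iff.rfl

theorem coef_smul_frobMap (c : M) (i j : ℤ) :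
    coef hk i (c • (frobMap K L M k j).toLinearMap) =
      if i ≡ j [ZMOD Module.finrank K L] then c else 0 := by
  rw [coef_smul, coef_frobMap]
  split_ifs <;> simp

theorem not_modEq_of_lt {m : ℕ} {i j : ℤ} (h1 : i ≠ j) (h2 : i < j + m) (h3 : j < i + m) :
    ¬ i ≡ j [ZMOD m] := by
  intro h
  rw [Int.modEq_iff_dvd] at h
  obtain ⟨c, hc⟩ := h
  have hm : 0 < (m : ℤ) := by omega
  have h4 : c < 1 := by nlinarith
  have h5 : -1 < c := by nlinarith
  have h6 : c = 0 := by omega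
  subst h6
  omega

theorem smul_frobMap_mem_twistedSpace {t : ℕ} (ht : t < Module.finrank K L) {η : M} {u : ℤ}
    {j : ℕ} (hj : j ∈ Finset.Ico 1 t) (d : M) :
    d • (frobMap K L M k j).toLinearMap ∈ twistedSpace hk t η u := by
  rw [Finset.mem_Ico] at hj
  rw [mem_twistedSpace]
  refine ⟨fun i hi hi' => ?_, ?_⟩
  · rw [coef_smul_frobMap, if_neg (not_modEq_of_lt (by omega) (by omega) (by omega))]
  · rw [coef_smul_frobMap, coef_smul_frobMap,
      if_neg (not_modEq_of_lt (by omega) (by omega) (by omega)),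
      if_neg (not_modEq_of_lt (by omega) (by omega) (by omega))]
    simp

theorem twist_mem_twistedSpace {t : ℕ} (ht1 : 1 ≤ t) (ht : t < Module.finrank K L) {η : M} {u : ℤ}
    (c : M) :
    c • (frobMap K L M k 0).toLinearMap +
      (η * fr K (-(k : ℤ) * u) c) • (frobMap K L M k t).toLinearMap ∈ twistedSpace hk t η u := by
  rw [mem_twistedSpace]
  refine ⟨fun i hi hi' => ?_, ?_⟩
  · rw [map_add, coef_smul_frobMap, coef_smul_frobMap,
      if_neg (not_modEq_of_lt (by omega) (by omega) (by omega)),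
      if_neg (not_modEq_of_lt (by omega) (by omega) (by omega)), add_zero]
  · rw [map_add, map_add, coef_smul_frobMap, coef_smul_frobMap, coef_smul_frobMap,
      coef_smul_frobMap, if_pos (Int.ModEq.refl _), if_pos (Int.ModEq.refl _),
      if_neg (not_modEq_of_lt (by omega) (by omega) (by omega)),
      if_neg (not_modEq_of_lt (by omega) (by omega) (by omega)), add_zero, zero_add]

theorem eq_of_mem_twistedSpace {t : ℕ} (ht1 : 1 ≤ t) (ht : t < Module.finrank K L) {η : M} {u : ℤ}
    {φ : L →ₗ[K] M} (hφ : φ ∈ twistedSpace hk t η u) :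
    φ = (coef hk 0 φ • (frobMap K L M k 0).toLinearMap +
      (η * fr K (-(k : ℤ) * u) (coef hk 0 φ)) • (frobMap K L M k t).toLinearMap) +
      ∑ j ∈ Finset.Ico 1 t, coef hk j φ • (frobMap K L M k j).toLinearMap := by
  apply coef_ext hk
  intro i
  have hpos : 0 < (Module.finrank K L : ℤ) := by exact_mod_cast Module.finrank_pos
  have h0 := Int.emod_nonneg i hpos.ne'
  have hlt := Int.emod_lt_of_pos i hpos
  obtain ⟨r, hr⟩ := Int.eq_ofNat_of_zero_le h0
  have hmod : i ≡ (r : ℤ) [ZMOD Module.finrank K L] := by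
    rw [← hr]
    exact (Int.mod_modEq _ _).symm
  rw [coef_congr hk hmod, coef_congr hk hmod, map_add, map_add, map_sum]
  simp only [coef_smul_frobMap]
  rw [mem_twistedSpace] at hφ
  have hsum : r ∉ Finset.Ico 1 t → (∑ j ∈ Finset.Ico 1 t,
      if (r : ℤ) ≡ (j : ℤ) [ZMOD Module.finrank K L] then coef hk j φ else 0) = 0 := by
    intro hr'
    refine Finset.sum_eq_zero fun j hj => ?_
    have hne : j ≠ r := by
      rintro rfl
      exact hr' hj
    rw [Finset.mem_Ico] at hj
    rw [if_neg (not_modEq_of_lt (by omega) (by omega) (by omega))]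
  by_cases hrt : r ∈ Finset.Ico 1 t
  · rw [Finset.sum_eq_single r]
    · rw [Finset.mem_Ico] at hrt
      rw [if_pos (Int.ModEq.refl _), if_neg (not_modEq_of_lt (by omega) (by omega) (by omega)),
        if_neg (not_modEq_of_lt (by omega) (by omega) (by omega)), add_zero, zero_add]
    · intro j hj hne
      rw [Finset.mem_Ico] at hj
      rw [if_neg (not_modEq_of_lt (by omega) (by omega) (by omega))]
    · exact fun h => absurd hrt h
  · rw [hsum hrt, add_zero]
    rw [Finset.mem_Ico] at hrt
    rcases Nat.lt_trichotomy r t with h | h | h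
    · have : r = 0 := by omega
      subst this
      rw [Nat.cast_zero, if_pos (Int.ModEq.refl _),
        if_neg (not_modEq_of_lt (by omega) (by omega) (by omega)), add_zero]
    · subst h
      rw [if_pos (Int.ModEq.refl _), if_neg (not_modEq_of_lt (by omega) (by omega) (by omega)),
        zero_add, hφ.2]
    · rw [if_neg (not_modEq_of_lt (by omega) (by omega) (by omega)),
        if_neg (not_modEq_of_lt (by omega) (by omega) (by omega)), add_zero,
        hφ.1 r (by omega) (by omega)]

/-- The trace is Galois invariant, so the Frobenius power on x' can be moved to the factor c x as
its inverse. Hence the expansion in negative powers of x ↦ x^{[k]}. -/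
theorem restrictForm_formMap (k j : ℕ) (c : M) :
    restrictForm K L M (formMap K M k j c) =
      toForm K L M (fr K (-(k : ℤ) * j) c • (frobMap K L M k j).toLinearMap) := by
  refine LinearMap.ext fun x => LinearMap.ext fun x' => ?_
  rw [toForm_apply, ← trace_fr ((k : ℤ) * j)]
  change Algebra.trace K M (c * algebraMap L M x * fr K ((k : ℤ) * j) x') = _
  simp only [LinearMap.smul_apply, AlgHom.toLinearMap_apply, frobMap_apply', smul_eq_mul, map_mul,
    ← fr_add]
  simp [fr_zero]

/-- The twist parameters come from (μ c^{[sk]})^{[-kt]} = σ^t(μ) σ^{t-s}(c). -/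
theorem mem_puncturedCode {t : ℕ} (ht1 : 1 ≤ t) (ht : t < Module.finrank K L) (μ : M) (s : ℤ)
    (φ : L →ₗ[K] M) :
    toForm K L M φ ∈ puncturedCode K L M k t μ s ↔
      φ ∈ twistedSpace hk t (fr K (-(k : ℤ) * t) μ) (t - s) := by
  have htw : ∀ c : M, restrictForm K L M ((formMap K M k 0 +
      formMap K M k t ∘ₗ LinearMap.mulLeft K μ ∘ₗ (fr K (s * k) : M ≃ₐ[K] M).toLinearMap) c) =
      toForm K L M (c • (frobMap K L M k 0).toLinearMap +
        (fr K (-(k : ℤ) * t) μ * fr K (-(k : ℤ) * (t - s)) c) •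
          (frobMap K L M k t).toLinearMap) := by
    intro c
    rw [LinearMap.add_apply, map_add, restrictForm_formMap, LinearMap.comp_apply,
      restrictForm_formMap, map_add]
    simp only [LinearMap.comp_apply, LinearMap.mulLeft_apply, AlgEquiv.toLinearMap_apply, map_mul,
      ← fr_add]
    congr 4
    · simp [fr_zero]
    · ring_nf
  constructor
  · intro h
    suffices hle : puncturedCode K L M k t μ s ≤
        (twistedSpace hk t (fr K (-(k : ℤ) * t) μ) (t - s)).map (toForm K L M).toLinearMap by
      obtain ⟨ψ, hψ, he⟩ := hle h
      rwa [← (toForm K L M).injective he]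
    rw [puncturedCode, Submodule.map_le_iff_le_comap, twistedCode, sup_le_iff]
    constructor
    · rintro _ ⟨c, rfl⟩
      rw [Submodule.mem_comap, htw]
      exact Submodule.mem_map_of_mem (twist_mem_twistedSpace hk ht1 ht c)
    · refine iSup₂_le fun j hj => ?_
      rintro _ ⟨c, rfl⟩
      rw [Submodule.mem_comap, restrictForm_formMap]
      exact Submodule.mem_map_of_mem (smul_frobMap_mem_twistedSpace hk ht hj _)
  · intro h
    rw [eq_of_mem_twistedSpace hk ht1 ht h, map_add, map_sum]
    refine add_mem ?_ (sum_mem fun j hj => ?_)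
    · rw [← htw]
      exact Submodule.mem_map_of_mem (Submodule.mem_sup_left ⟨_, rfl⟩)
    · have := restrictForm_formMap (K := K) (L := L) k j (fr K ((k : ℤ) * j) (coef hk j φ))
      rw [← fr_add, neg_mul, neg_add_cancel, fr_zero] at this
      rw [← this]
      refine Submodule.mem_map_of_mem (Submodule.mem_sup_right ?_)
      exact Submodule.mem_iSup_of_mem j (Submodule.mem_iSup_of_mem hj ⟨_, rfl⟩)

end TraceForms

/-! ### Supports subject to two-term relations -/

section Combinatorics

/-- Two elements of {0, 1} differ by 0 or ±1, and 1 - s is none of these. -/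
theorem not_eq_of_eq_zero_or_one {R : Type*} [CommRing R] {s x j : R}
    (hs0 : s ≠ 0) (hs1 : s ≠ 1) (hs2 : s ≠ 2) (h : x + j = 0 ∨ x + j = 1) :
    ¬ (x + (j + (1 - s)) = 0 ∨ x + (j + (1 - s)) = 1) := by
  rintro (h' | h') <;> rcases h with h | h
  · exact hs1 (by linear_combination h - h')
  · exact hs2 (by linear_combination h - h')
  · exact hs0 (by linear_combination h - h')
  · exact hs1 (by linear_combination h - h')

/-- Three terms of an arithmetic progression with difference d = 2(1 - s) lie in {0, 1}. If d ≠ 0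
they alternate, so d = ±1 and 2d = 0, contradicting 2 ≠ 0. -/
theorem two_mul_eq_two {R : Type*} [CommRing R] (h1 : (1 : R) ≠ 0) (h2 : (2 : R) ≠ 0)
    {s x j : R} (e0 : x + j = 0 ∨ x + j = 1)
    (e1 : x + (j + 2 * (1 - s)) = 0 ∨ x + (j + 2 * (1 - s)) = 1)
    (e2 : x + (j + 2 * (1 - s) + 2 * (1 - s)) = 0 ∨ x + (j + 2 * (1 - s) + 2 * (1 - s)) = 1) :
    2 * s = 2 := by
  grind

/-- By pigeonhole two of the three translates fall in the same pair of consecutive elements, so 2 or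
4 would equal 0 or ±1. -/
theorem not_three_even_translates {R : Type*} [CommRing R] (h1 : (1 : R) ≠ 0) (h2 : (2 : R) ≠ 0)
    (h3 : (3 : R) ≠ 0) (h4 : (4 : R) ≠ 0) (h5 : (5 : R) ≠ 0) {x j v : R}
    (c0 : (x + j = 0 ∨ x + j = 1) ∨ (x + j + v = 0 ∨ x + j + v = 1))
    (c1 : (x - 2 + j = 0 ∨ x - 2 + j = 1) ∨ (x - 2 + j + v = 0 ∨ x - 2 + j + v = 1))
    (c2 : (x - 2 - 2 + j = 0 ∨ x - 2 - 2 + j = 1) ∨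
      (x - 2 - 2 + j + v = 0 ∨ x - 2 - 2 + j + v = 1)) : False := by
  grind

set_option maxHeartbeats 1000000 in
/-- Let `a`, `a'` be functions on the ring `R`, the support of `a'` being that of `a` shifted by
`s`, that are not proportional to each other. If, for every `j`, `γ j` and `ε j` give a linear
relation between `a` and `a'` outside `{-j, 1 - j}`, where the support of `ε` is that of `γ`
shifted by `1 - s`, then the supports of `a` and `γ` are opposite to each other. -/
theorem add_eq_zero_of_relations {R E : Type*} [CommRing R] [Field E]
    (h1 : (1 : R) ≠ 0) (h2 : (2 : R) ≠ 0) (h3 : (3 : R) ≠ 0) (h4 : (4 : R) ≠ 0) (h5 : (5 : R) ≠ 0)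
    (s : ℤ) (hs0 : (s : R) ≠ 0) (hs1 : (s : R) ≠ 1) (hs1' : (s : R) ≠ -1) (hs2 : (s : R) ≠ 2)
    (a a' : R → E) (haa' : ∀ α, a' (α + s) = 0 ↔ a α = 0)
    (hprop : ∀ c : E, ¬ ∀ α, a α = c * a' α)
    (γ ε : ℤ → E) (hγε : ∀ j, ε (j + (1 - s)) = 0 ↔ γ j = 0)
    (hrel : ∀ (j : ℤ) (α : R), α + j ≠ 0 → α + j ≠ 1 → γ j * a α + ε j * a' α = 0)
    (α₀ : R) (j₀ : ℤ) (hα₀ : a α₀ ≠ 0) (hj₀ : γ j₀ ≠ 0) : α₀ + j₀ = 0 := by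
  by_contra hsum
  have haa : ∀ α, a' α = 0 ↔ a (α - s) = 0 := fun α => by rw [← haa', sub_add_cancel]
  -- two elements of the support
  have htwo : ∃ α β, a α ≠ 0 ∧ a β ≠ 0 ∧ α ≠ β := by
    by_cases hd : α₀ + j₀ = 1
    · have h := hrel (j₀ + (1 - s)) (α₀ + s) (by push_cast; grind) (by push_cast; grind)
      have hne : ε (j₀ + (1 - s)) * a' (α₀ + s) ≠ 0 :=
        mul_ne_zero (fun h => hj₀ ((hγε _).mp h)) (fun h => hα₀ ((haa' _).mp h))
      refine ⟨α₀, α₀ + s, hα₀, fun h0 => hne ?_, by grind⟩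
      rwa [h0, mul_zero, zero_add] at h
    · have h := hrel j₀ α₀ hsum hd
      refine ⟨α₀, α₀ - s, hα₀, fun h0 => mul_ne_zero hj₀ hα₀ ?_, by grind⟩
      rwa [(haa _).mpr h0, mul_zero, add_zero] at h
  have hboth : ∀ β₁ β₂ : R, (∀ α, a α ≠ 0 → α = β₁ ∨ α = β₂) → a β₁ ≠ 0 ∧ a β₂ ≠ 0 := by
    obtain ⟨α, β, h, h', hne⟩ := htwo
    intro β₁ β₂ hβ
    rcases hβ α h with rfl | rfl <;> rcases hβ β h' with rfl | rfl <;> grind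
  -- the support of `γ` is closed under subtraction of `1 - s`
  have hdown : ∀ j, γ (j + (1 - s)) ≠ 0 → γ j ≠ 0 := by
    intro i hi h0
    obtain ⟨j, rfl⟩ : ∃ j, i = j - (1 - s) := ⟨i + (1 - s), by ring⟩
    rw [sub_add_cancel] at hi
    have hε : ε j = 0 := by
      have := (hγε (j - (1 - s))).mpr h0
      rwa [sub_add_cancel] at this
    -- With ε j = 0 the relation at j confines the support of `a` to two points; having at least two
    -- elements, the support is exactly this pair.
    have hsupp : ∀ α, a α ≠ 0 → α = -(j : R) ∨ α = 1 - j := by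
      intro α hα
      by_contra hcon
      have := hrel j α (by grind) (by grind)
      rw [hε, zero_mul, add_zero] at this
      exact mul_ne_zero hi hα this
    have hb := (hboth _ _ hsupp).2
    have ha' : a' (1 - j) = 0 := by
      rw [haa]
      by_contra hcon
      have := hsupp _ hcon
      grind
    -- Here index and argument add up to 2 - s, so the relation applies and kills γ (j + (1 - s)).
    -- In `e3` they add up to 2, and the surviving term is nonzero.
    have e1 := hrel (j + (1 - s)) (1 - j) (by push_cast; grind) (by push_cast; grind)
    rw [ha', mul_zero, add_zero] at e1
    have e2 : γ (j + (1 - s)) = 0 := (mul_eq_zero.mp e1).resolve_right hb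
    have e3 := hrel (j + (1 - s)) (1 - j + s) (by push_cast; grind) (by push_cast; grind)
    rw [e2, zero_mul, zero_add] at e3
    rcases mul_eq_zero.mp e3 with h | h
    · exact hi ((hγε _).mp h)
    · exact hb ((haa' _).mp h)
  -- the support of `γ` is closed under addition of `1 - s`
  have hup : ∀ j, γ j ≠ 0 → γ (j + (1 - s)) ≠ 0 := by
    intro j hj h0
    have hε : ε (j + (1 - s)) ≠ 0 := fun h => hj ((hγε _).mp h)
    -- Only the ε-term survives at index j + (1 - s); evaluated at α + s it again confines the
    -- support of `a` to a pair. The condition s ≠ -1 then gives a' (-1 - j) = 0.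
    have hsupp : ∀ α, a α ≠ 0 → α = -1 - (j : R) ∨ α = -j := by
      intro α hα
      by_contra hcon
      have := hrel (j + (1 - s)) (α + s) (by push_cast; grind) (by push_cast; grind)
      rw [h0, zero_mul, zero_add] at this
      exact mul_ne_zero hε (fun h => hα ((haa' _).mp h)) this
    have hb := (hboth _ _ hsupp).1
    have ha' : a' (-1 - j) = 0 := by
      rw [haa]
      by_contra hcon
      have := hsupp _ hcon
      grind
    have e1 := hrel j (-1 - j) (by grind) (by grind)
    rw [ha', mul_zero, add_zero] at e1
    exact mul_ne_zero hj hb e1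
  -- relations between `a` and `a'`
  have hlam : ∀ j, γ j ≠ 0 → ∃ c : E, c ≠ 0 ∧ ∀ α : R, α + j ≠ 0 → α + j ≠ 1 →
      a α = c * a' α := by
    intro j hj
    have hε : ε j ≠ 0 := by
      intro h
      have h' := hγε (j - (1 - s))
      have h'' := hdown (j - (1 - s))
      rw [sub_add_cancel] at h' h''
      exact h'' hj (h'.mp h)
    refine ⟨-(ε j / γ j), neg_ne_zero.mpr (div_ne_zero hε hj), fun α h0 h1 => ?_⟩
    have := hrel j α h0 h1
    field_simp
    linear_combination this
  -- Otherwise the proportionality constants for j and for j + (1 - s) agree, being compared at α.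
  -- The exceptional pairs of these two indices are disjoint, so `a` would be proportional to `a'`
  -- everywhere.
  have hcov : ∀ j, γ j ≠ 0 → ∀ α : R, (a α ≠ 0 ∨ a' α ≠ 0) →
      (α + j = 0 ∨ α + j = 1) ∨ (α + j + (1 - s) = 0 ∨ α + j + (1 - s) = 1) := by
    intro j hj α hα
    by_contra hcon
    simp only [not_or] at hcon
    obtain ⟨⟨n0, n1⟩, n2, n3⟩ := hcon
    obtain ⟨c, hc, hca⟩ := hlam j hj
    obtain ⟨d, hd, hda⟩ := hlam _ (hup j hj)
    push_cast at hda
    have e1 := hca α n0 n1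
    have e2 := hda α (by rwa [← add_assoc]) (by rwa [← add_assoc])
    have ha' : a' α ≠ 0 := by
      intro h
      rw [h, mul_zero] at e1
      exact hα.elim (fun h' => h' e1) (fun h' => h' h)
    have hcd : c = d := mul_right_cancel₀ ha' (e1.symm.trans e2)
    refine hprop c fun β => ?_
    by_cases hβ : β + j = 0 ∨ β + j = 1
    · rw [hcd]
      clear * - hβ hs0 hs1 hs2 hda
      refine hda β (fun h => ?_) (fun h => ?_)
      · rcases hβ with hβ | hβ
        · exact hs1 (by linear_combination hβ - h)
        · exact hs2 (by linear_combination hβ - h)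
      · rcases hβ with hβ | hβ
        · exact hs0 (by linear_combination hβ - h)
        · exact hs1 (by linear_combination hβ - h)
    · rw [not_or] at hβ
      exact hca β hβ.1 hβ.2
  have hT1 := hup _ hj₀
  -- A support point in the exceptional pair of j is outside that of j + (1 - s), hence by `hcov`
  -- inside that of j + 2(1 - s). Doing this twice gives 2s = 2. Being outside the pair of j + (1 -
  -- s) also forces a' α ≠ 0.
  have key : ∀ α, a α ≠ 0 → 2 * (s : R) = 2 ∧ a (α - s) ≠ 0 := by
    intro α hα
    have hout : ∀ j, γ j ≠ 0 → α + j ≠ 0 → α + j ≠ 1 → a (α - s) ≠ 0 := by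
      intro j hj h0 h1 h
      obtain ⟨c, hc, hca⟩ := hlam j hj
      rw [hca α h0 h1, (haa α).mpr h, mul_zero] at hα
      exact hα rfl
    have alt : ∀ j, γ j ≠ 0 → (α + j = 0 ∨ α + j = 1) →
        (α + (j + 2 * (1 - s) : ℤ) = 0 ∨ α + (j + 2 * (1 - s) : ℤ) = 1) ∧
          γ (j + 2 * (1 - s)) ≠ 0 := by
      intro j hj hF
      have hj' := hup _ hj
      have hj'' := hup _ hj'
      rw [show j + (1 - s) + (1 - s) = j + 2 * (1 - s) by ring] at hj''
      refine ⟨?_, hj''⟩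
      have c1 := hcov _ hj' α (Or.inl hα)
      push_cast at c1 ⊢
      rw [show α + (j + (1 - s)) + (1 - s) = α + (j + 2 * (1 - (s : R))) by ring] at c1
      exact c1.resolve_left (not_eq_of_eq_zero_or_one hs0 hs1 hs2 hF)
    have fin : ∀ j, γ j ≠ 0 → (α + j = 0 ∨ α + j = 1) → 2 * (s : R) = 2 ∧ a (α - s) ≠ 0 := by
      intro j hj hF
      obtain ⟨hF', hj'⟩ := alt j hj hF
      obtain ⟨hF'', -⟩ := alt _ hj' hF'
      push_cast at hF' hF''
      have hn := not_eq_of_eq_zero_or_one hs0 hs1 hs2 hF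
      rw [not_or] at hn
      refine ⟨two_mul_eq_two h1 h2 hF hF' hF'', ?_⟩
      have hj1 := hup _ hj
      refine hout _ hj1 ?_ ?_ <;> push_cast
      · exact hn.1
      · exact hn.2
    rcases hcov _ hj₀ α (Or.inl hα) with hF | hF
    · exact fin j₀ hj₀ hF
    · refine fin _ hT1 ?_
      push_cast
      rwa [← add_assoc]
  -- Two steps of length s amount to 2, since 2s = 2. The support then contains α₀, α₀ - 2 and α₀ -
  -- 4, too many for two pairs of consecutive elements.
  have hsub : ∀ α, a α ≠ 0 → a (α - 2) ≠ 0 := by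
    intro α hα
    obtain ⟨hs, h⟩ := key α hα
    have h' := (key _ h).2
    rwa [show α - 2 = α - s - s by linear_combination hs]
  have hα₂ := hsub _ hα₀
  have hα₄ := hsub _ hα₂
  have c0 := hcov _ hj₀ _ (Or.inl hα₀)
  have c1 := hcov _ hj₀ _ (Or.inl hα₂)
  have c2 := hcov _ hj₀ _ (Or.inl hα₄)
  exact not_three_even_translates h1 h2 h3 h4 h5 c0 c1 c2

end Combinatorics

/-! ### Opposite supports: coefficient relations, the untwisted case and the case t ≥ 2 -/

section Monomial

/-- Supports are opposite as soon as the coefficients vanish off one residue class. -/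
theorem modEq_zero_of_forall_Ico {E : Type*} [Zero E] {a : ℤ → E} {m : ℕ} (hm : 0 < m)
    (ha : ∀ i j : ℤ, i ≡ j [ZMOD m] → a i = a j) (j : ℤ)
    (h : ∀ w : ℤ, 1 ≤ w → w < m → a (w - j) = 0) (i : ℤ) (hi : a i ≠ 0) :
    i + j ≡ 0 [ZMOD m] := by
  by_contra hcon
  have hpos : 0 < (m : ℤ) := by exact_mod_cast hm
  have h0 := Int.emod_nonneg (i + j) hpos.ne'
  have hlt := Int.emod_lt_of_pos (i + j) hpos
  have hne : (i + j) % m ≠ 0 := fun h => hcon (by rw [Int.ModEq, h, Int.zero_emod])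
  apply hi
  rw [ha i ((i + j) % m - j), h _ (by omega) hlt]
  have := (Int.mod_modEq (i + j) m).symm.sub_right j
  rwa [add_sub_cancel_right] at this

variable {K L M : Type*} [Field K] [Fintype K] [Field L] [Finite L] [Field M] [Finite M]
  [Algebra K L] [Algebra K M] [Algebra L M] [IsScalarTower K L M]
  {k : ℕ} (hk : Nat.Coprime k (Module.finrank K L)) (hkM : Nat.Coprime k (Module.finrank K M))

theorem coef_comp_fr (u i : ℤ) (φ : L →ₗ[K] M) :
    coef hk i (φ ∘ₗ (fr K (-(k : ℤ) * u) : L ≃ₐ[K] L).toLinearMap) = coef hk (i - u) φ := by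
  apply coef_eq_of_sum hk (c := fun i => coef hk (i - u) φ)
  · intro a b hab
    simp only [coef_congr hk (hab.sub_right u)]
  · intro x
    have h := sum_shift_of_periodic (m := Module.finrank K L) Module.finrank_pos
      (fun i => coef hk (i - u) φ * frobMap K L M k i x)
      (by
        intro a b hab
        simp only [coef_congr hk (hab.sub_right u), frobMap_congr K hab]) u
    rw [← h, LinearMap.comp_apply, eq_sum_coef hk φ]
    refine Finset.sum_congr rfl fun i _ => ?_
    rw [add_sub_cancel_right, frobMap_apply, frobMap_apply, AlgEquiv.toLinearMap_apply, ← fr_add]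
    congr 3
    ring_nf

theorem frobMap_ne_zero {i : ℤ} {x : L} (hx : x ≠ 0) : frobMap K L M k i x ≠ 0 :=
  (map_ne_zero (frobMap K L M k i)).mpr hx

variable {G : M →ₗ[K] M} {A : L →ₗ[K] L} {t : ℕ} {u : ℤ} {η η' : M}

/-- The coefficients of the image of the middle components. -/
theorem coef_middle_eq_zero (ht : t < Module.finrank K L)
    (h : ∀ φ ∈ twistedSpace hk t η u, G ∘ₗ φ ∘ₗ A ∈ twistedSpace hk t η' u)
    {l : ℕ} (hl : l ∈ Finset.Ico 1 t) {j v : ℤ} (hv : t < v) (hv' : v < Module.finrank K L)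
    (hj : coef hkM j G ≠ 0) : coef hk (v - j - l) A = 0 := by
  have h0 : coef hk v ∘ₗ sandwich k G A l = 0 := by
    refine LinearMap.ext fun d => ?_
    have := h _ (smul_frobMap_mem_twistedSpace hk ht hl d)
    exact this.1 v hv hv'
  have h1 := coef_sandwich hk hkM G A l v j
  rw [h0, map_zero] at h1
  by_contra hne
  exact mul_ne_zero hj (frobMap_ne_zero hne) h1.symm

/-- The twist condition at index t, decoupled through `coef_sandwich`: applying σ^u on the right
shifts the index of G to j - u. -/
theorem coef_middle_twist (ht : t < Module.finrank K L)
    (h : ∀ φ ∈ twistedSpace hk t η u, G ∘ₗ φ ∘ₗ A ∈ twistedSpace hk t η' u)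
    {l : ℕ} (hl : l ∈ Finset.Ico 1 t) (j : ℤ) :
    coef hkM j G * frobMap K L M k (j + l) (coef hk (t - j - l) A) =
      η' * fr K (-(k : ℤ) * u) (coef hkM (j - u) G *
        frobMap K L M k (j - u + l) (coef hk (u - j - l) A)) := by
  have h0 : coef hk t ∘ₗ sandwich k G A l = LinearMap.mulLeft K η' ∘ₗ
      (fr K (-(k : ℤ) * u) : M ≃ₐ[K] M).toLinearMap ∘ₗ (coef hk 0 ∘ₗ sandwich k G A l) := by
    refine LinearMap.ext fun d => ?_
    have := h _ (smul_frobMap_mem_twistedSpace hk ht hl d)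
    exact this.2
  have h1 := coef_sandwich hk hkM G A l t j
  rw [h0, coef_mul_comp, coef_fr, coef_sandwich] at h1
  rw [← h1, show 0 - (j - u) - (l : ℤ) = u - j - l by ring]

/-- The twisted generator has components in degrees 0 and t, so decoupling leaves two products
instead of one. -/
theorem coef_twisted (ht1 : 1 ≤ t) (ht : t < Module.finrank K L)
    (h : ∀ φ ∈ twistedSpace hk t η u, G ∘ₗ φ ∘ₗ A ∈ twistedSpace hk t η' u)
    (j : ℤ) {v : ℤ} (hv : t < v) (hv' : v < Module.finrank K L) :
    coef hkM j G * frobMap K L M k j (coef hk (v - j) A) +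
      coef hkM (j - u) G * frobMap K L M k (j - u + t) (coef hk (v - (j - u) - t) A) *
        fr K (-(k : ℤ) * (j - u)) η = 0 := by
  have h0 : coef hk v ∘ₗ sandwich k G A 0 + ((coef hk v ∘ₗ sandwich k G A t) ∘ₗ
      LinearMap.mulLeft K η) ∘ₗ (fr K (-(k : ℤ) * u) : M ≃ₐ[K] M).toLinearMap = 0 := by
    refine LinearMap.ext fun d => ?_
    have h2 := (h _ (twist_mem_twistedSpace hk ht1 ht d)).1 v hv hv'
    rw [LinearMap.add_comp, LinearMap.comp_add, map_add] at h2
    exact h2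
  have h1 := congrArg (coef hkM j) h0
  rw [map_add, coef_comp_fr, coef_comp_mul, coef_sandwich, coef_sandwich, map_zero, add_zero,
    sub_zero] at h1
  exact h1

theorem coef_twisted_top (ht1 : 1 ≤ t) (ht : t < Module.finrank K L)
    (h : ∀ φ ∈ twistedSpace hk t 0 u, G ∘ₗ φ ∘ₗ A ∈ twistedSpace hk t 0 u)
    {j : ℤ} (hj : coef hkM j G ≠ 0) : coef hk (t - j) A = 0 := by
  have h0 : coef hk t ∘ₗ sandwich k G A 0 = 0 := by
    refine LinearMap.ext fun d => ?_
    have h2 := (h _ (twist_mem_twistedSpace hk ht1 ht d)).2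
    rw [zero_mul, zero_mul, zero_smul, add_zero] at h2
    exact h2
  have h1 := coef_sandwich hk hkM G A 0 t j
  rw [h0, map_zero, add_zero, sub_zero] at h1
  by_contra hne
  exact mul_ne_zero hj (frobMap_ne_zero hne) h1.symm

/-- Without twist the space consists of all polynomials in σ of degree below t. The generators σ^l
with l < t must yield no coefficient of index v with t ≤ v < m, and the differences v - l run
through 1, …, m - 1. -/
theorem modEq_zero_of_untwisted (ht1 : 1 ≤ t) (ht : t + 2 ≤ Module.finrank K L)
    (h : ∀ φ ∈ twistedSpace hk t 0 u, G ∘ₗ φ ∘ₗ A ∈ twistedSpace hk t 0 u)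
    {i j : ℤ} (hi : coef hk i A ≠ 0) (hj : coef hkM j G ≠ 0) :
    i + j ≡ 0 [ZMOD Module.finrank K L] := by
  refine modEq_zero_of_forall_Ico (a := fun i => coef hk i A) Module.finrank_pos
    (fun i j hij => coef_congr hk hij A) j (fun w hw hw' => ?_) i hi
  rcases lt_trichotomy w t with hwt | rfl | hwt
  · obtain ⟨l, hl⟩ := Int.eq_ofNat_of_zero_le (show 0 ≤ (t : ℤ) + 1 - w by omega)
    by_cases hw1 : w = 1
    · subst hw1
      have h0 := coef_middle_twist hk hkM (by omega) h
        (show t - 1 ∈ Finset.Ico 1 t by rw [Finset.mem_Ico]; omega) j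
      rw [zero_mul, mul_eq_zero] at h0
      have h2 := h0.resolve_left hj
      rw [map_eq_zero] at h2
      rw [← h2]
      congr 2
      push_cast [ht1]
      ring
    · have := coef_middle_eq_zero hk hkM (by omega) h
        (show l ∈ Finset.Ico 1 t by rw [Finset.mem_Ico]; omega) (j := j)
        (v := t + 1) (by omega) (by omega) hj
      rw [← this]
      congr 2
      omega
  · exact coef_twisted_top hk hkM ht1 (by omega) h hj
  · have := coef_twisted hk hkM ht1 (by omega) h j hwt hw'
    rw [map_zero, mul_zero, add_zero, mul_eq_zero] at this
    have h2 := this.resolve_left hj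
    rwa [map_eq_zero] at h2

/-- The middle components σ^l, 1 ≤ l < t, exclude every residue i + j except 0, 1 and -1. The twist
condition ties each of the residues 1 and -1 to a residue excluded already, and this is where s ≢ 0,
1, 2 enters. -/
theorem modEq_zero_of_two_le (ht1 : 2 ≤ t) (ht : t + 2 ≤ Module.finrank K L) {s : ℤ}
    (hs0 : ¬ s ≡ 0 [ZMOD Module.finrank K L]) (hs1 : ¬ s ≡ 1 [ZMOD Module.finrank K L])
    (hs2 : ¬ s ≡ 2 [ZMOD Module.finrank K L])
    (hη' : η' ≠ 0)
    (h : ∀ φ ∈ twistedSpace hk t η (t - s), G ∘ₗ φ ∘ₗ A ∈ twistedSpace hk t η' (t - s))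
    {i j : ℤ} (hi : coef hk i A ≠ 0) (hj : coef hkM j G ≠ 0) :
    i + j ≡ 0 [ZMOD Module.finrank K L] := by
  have hmid : ∀ j, coef hkM j G ≠ 0 → ∀ w : ℤ, 2 ≤ w → w + 2 ≤ Module.finrank K L →
      coef hk (w - j) A = 0 := by
    intro j hj w hw hw'
    by_cases hwt : t ≤ w
    · rw [← coef_middle_eq_zero hk hkM (by omega) h
        (show 1 ∈ Finset.Ico 1 t by rw [Finset.mem_Ico]; omega) (j := j)
        (v := w + 1) (by omega) (by omega) hj]
      congr 2
      push_cast
      ring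
    · obtain ⟨l, hl⟩ := Int.eq_ofNat_of_zero_le (show 0 ≤ (t : ℤ) + 1 - w by omega)
      rw [← coef_middle_eq_zero hk hkM (by omega) h
        (show l ∈ Finset.Ico 1 t by rw [Finset.mem_Ico]; omega) (j := j)
        (v := t + 1) (by omega) (by omega) hj]
      congr 2
      omega
  have hmid' : ∀ j, coef hkM j G ≠ 0 → ∀ w : ℤ, ¬ w ≡ 0 [ZMOD Module.finrank K L] →
      ¬ w ≡ 1 [ZMOD Module.finrank K L] → ¬ w ≡ -1 [ZMOD Module.finrank K L] →
      coef hk (w - j) A = 0 := by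
    intro j hj w hw0 hw1 hw2
    have hpos : 0 < (Module.finrank K L : ℤ) := by exact_mod_cast Module.finrank_pos
    have h0 := Int.emod_nonneg w hpos.ne'
    have hlt := Int.emod_lt_of_pos w hpos
    have hmod := Int.mod_modEq w (Module.finrank K L)
    rw [← coef_congr hk (hmod.sub_right j)]
    have n0 : w % Module.finrank K L ≠ 0 := fun h => hw0 (by rw [h] at hmod; exact hmod.symm)
    have n1 : w % Module.finrank K L ≠ 1 := fun h => hw1 (by rw [h] at hmod; exact hmod.symm)
    have n2 : w % Module.finrank K L ≠ Module.finrank K L - 1 := by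
      intro h
      rw [h] at hmod
      refine hw2 (hmod.symm.trans ?_)
      rw [Int.modEq_iff_dvd]
      exact ⟨-1, by ring⟩
    exact hmid j hj _ (by omega) (by omega)
  refine modEq_zero_of_forall_Ico (a := fun i => coef hk i A) Module.finrank_pos
    (fun i j hij => coef_congr hk hij A) j (fun w hw hw' => ?_) i hi
  by_cases hw1 : w = 1
  · subst hw1
    -- With l = t - 1 the left side contains the coefficient of A at 1 - j, and the right side the
    -- one at (1 - s) - j, where 1 - s ≢ 0, 1, -1.
    have h0 := coef_middle_twist hk hkM (by omega) h
      (show t - 1 ∈ Finset.Ico 1 t by rw [Finset.mem_Ico]; omega) j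
    have hz : coef hk (t - s - j - (t - 1 : ℕ)) A = 0 := by
      have := hmid' j hj (1 - s) (fun hc => hs1 ?_) (fun hc => hs0 ?_) (fun hc => hs2 ?_)
      · rw [← this]
        congr 2
        push_cast [show 1 ≤ t by omega]
        ring
      · simpa using (hc.sub_left 1)
      · simpa using (hc.sub_left 1)
      · simpa using (hc.sub_left 1)
    rw [hz, map_zero, mul_zero, map_zero, mul_zero, mul_eq_zero] at h0
    have h2 := h0.resolve_left hj
    rw [map_eq_zero] at h2
    rw [← h2]
    congr 2
    push_cast [show 1 ≤ t by omega]
    ring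
  · by_cases hw2 : w + 2 ≤ Module.finrank K L
    · exact hmid j hj w (by omega) hw2
    · have hwm : w = Module.finrank K L - 1 := by omega
      -- Taking l = 1 and the index j + (t - s) exchanges the roles: the left side vanishes through
      -- residue s - 1, and the right side contains the coefficient of A at -1 - j.
      have h0 := coef_middle_twist hk hkM (by omega) h
        (show 1 ∈ Finset.Ico 1 t by rw [Finset.mem_Ico]; omega) (j + (t - s))
      have hz : coef hk (t - (j + (t - s)) - (1 : ℕ)) A = 0 := by
        have := hmid' j hj (s - 1) (fun hc => hs1 ?_) (fun hc => hs2 ?_) (fun hc => hs0 ?_)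
        · rw [← this]
          congr 2
          push_cast
          ring
        · simpa using (hc.add_right 1)
        · simpa using (hc.add_right 1)
        · simpa using (hc.add_right 1)
      rw [hz, map_zero, mul_zero, eq_comm, mul_eq_zero, map_eq_zero, mul_eq_zero,
        add_sub_cancel_right] at h0
      have h2 := (h0.resolve_left hη').resolve_left hj
      rw [map_eq_zero] at h2
      rw [← h2]
      refine coef_congr hk ?_ A
      rw [Int.modEq_iff_dvd]
      exact ⟨-1, by rw [hwm]; push_cast; ring⟩

end Monomial

/-! ### Opposite supports: the case t = 1 and the general statement -/

section Monomial

variable {K L M : Type*} [Field K] [Fintype K] [Field L] [Finite L] [Field M] [Finite M]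
  [Algebra K L] [Algebra K M] [Algebra L M] [IsScalarTower K L M]
  {k : ℕ} (hk : Nat.Coprime k (Module.finrank K L)) (hkM : Nat.Coprime k (Module.finrank K M))
  {G : M →ₗ[K] M} {A : L →ₗ[K] L} {t : ℕ} {η η' : M}

/-- The hypothesis says A = c σ^s A. As A is surjective, y = c σ^s(y) on L; y = 1 gives c = 1, so
σ^s is the identity. -/
theorem coef_not_proportional {s : ℤ} (hs0 : ¬ s ≡ 0 [ZMOD Module.finrank K L])
    (hA : Function.Surjective A) (c : M)
    (h : ∀ i, algebraMap L M (coef hk i A) = c * frobMap K L M k s (coef hk (i - s) A)) :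
    False := by
  have h1 : (IsScalarTower.toAlgHom K L M).toLinearMap ∘ₗ A =
      c • ((frobMap K L M k s).toLinearMap ∘ₗ A) := by
    apply coef_ext hk
    intro i
    rw [coef_algebraMap_comp, coef_smul, coef_frobMap_comp, h]
  have h2 : ∀ y : L, algebraMap L M y = c * frobMap K L M k s y := by
    intro y
    obtain ⟨x, rfl⟩ := hA y
    exact LinearMap.congr_fun h1 x
  have hc : c = 1 := by
    have := h2 1
    rw [map_one, map_one, mul_one] at this
    exact this.symm
  refine hs0 ((frobMap_eq_iff K (M := M) hk s 0).mp ?_)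
  refine AlgHom.ext fun y => ?_
  have := h2 y
  rw [hc, one_mul] at this
  rw [← this, frobMap_apply, mul_zero, fr_zero]

theorem ne_zero_of_lt {m : ℕ} (d : ℕ) (hd : 0 < d) (hdm : d < m) : (d : ZMod m) ≠ 0 := by
  rw [Ne, ZMod.natCast_eq_zero_iff]
  exact Nat.not_dvd_of_pos_of_lt hd hdm

/-- This makes 1, …, 5 nonzero in ℤ/m, as `add_eq_zero_of_relations` needs. -/
theorem six_le_of_not_modEq {m : ℕ} (hm : 3 ≤ m) {s : ℤ} (hs0 : ¬ s ≡ 0 [ZMOD m])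
    (hs1 : ¬ s ≡ 1 [ZMOD m]) (hs1' : ¬ s ≡ -1 [ZMOD m]) (hs2 : ¬ s ≡ 2 [ZMOD m])
    (hs2' : ¬ s ≡ -2 [ZMOD m]) : 6 ≤ m := by
  by_contra hlt
  have hm' : m = 3 ∨ m = 4 ∨ m = 5 := by omega
  simp only [Int.ModEq] at *
  rcases hm' with rfl | rfl | rfl <;> omega

/-- For t = 1 there are no middle components. Applying σ^{-j} to the relations of `coef_twisted`
makes the factors coming from A depend only on α = v - j. They become relations between a(α) = a_α
and a'(α) = σ^s(a_{α-s}) over ℤ/m, failing only for v = 0, 1. -/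
theorem modEq_zero_of_one {s : ℤ} (hm : 3 ≤ Module.finrank K L)
    (hs0 : ¬ s ≡ 0 [ZMOD Module.finrank K L]) (hs1 : ¬ s ≡ 1 [ZMOD Module.finrank K L])
    (hs1' : ¬ s ≡ -1 [ZMOD Module.finrank K L]) (hs2 : ¬ s ≡ 2 [ZMOD Module.finrank K L])
    (hs2' : ¬ s ≡ -2 [ZMOD Module.finrank K L])
    (hη : η ≠ 0) (hA : Function.Surjective A)
    (h : ∀ φ ∈ twistedSpace hk 1 η (1 - s), G ∘ₗ φ ∘ₗ A ∈ twistedSpace hk 1 η' (1 - s))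
    {i j : ℤ} (hi : coef hk i A ≠ 0) (hj : coef hkM j G ≠ 0) :
    i + j ≡ 0 [ZMOD Module.finrank K L] := by
  have hm6 := six_le_of_not_modEq hm hs0 hs1 hs1' hs2 hs2'
  have : NeZero (Module.finrank K L) := ⟨by omega⟩
  have hcast : ∀ (x y : ℤ), (x : ZMod (Module.finrank K L)) = (y : ZMod (Module.finrank K L)) ↔ x ≡ y [ZMOD Module.finrank K L] :=
    fun x y => ZMod.intCast_eq_intCast_iff x y _
  have hz : ∀ z : ZMod (Module.finrank K L), ((z.cast : ℤ) : ZMod (Module.finrank K L)) = z := ZMod.intCast_zmod_cast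
  have hs : ∀ c : ℤ, ¬ s ≡ c [ZMOD Module.finrank K L] → (s : ZMod (Module.finrank K L)) ≠ (c : ZMod (Module.finrank K L)) := fun c hc h' =>
    hc ((hcast s c).mp h')
  rw [← hcast]
  push_cast
  refine add_eq_zero_of_relations (R := ZMod (Module.finrank K L)) (E := M)
    (by simpa using ne_zero_of_lt (m := Module.finrank K L) 1 (by omega) (by omega))
    (by simpa using ne_zero_of_lt (m := Module.finrank K L) 2 (by omega) (by omega))
    (by simpa using ne_zero_of_lt (m := Module.finrank K L) 3 (by omega) (by omega))
    (by simpa using ne_zero_of_lt (m := Module.finrank K L) 4 (by omega) (by omega))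
    (by simpa using ne_zero_of_lt (m := Module.finrank K L) 5 (by omega) (by omega))
    s (by simpa using hs 0 hs0) (by simpa using hs 1 hs1) (by simpa using hs (-1) hs1')
    (by simpa using hs 2 hs2)
    (fun z => algebraMap L M (coef hk (z.cast : ℤ) A))
    (fun z => frobMap K L M k s (coef hk ((z.cast : ℤ) - s) A)) ?_ ?_
    (fun j => fr K ((k : ℤ) * j) (coef hkM j G))
    (fun j => fr K ((k : ℤ) * j)
      (coef hkM (j - (1 - s)) G * fr K (-(k : ℤ) * (j - (1 - s))) η)) ?_ ?_ _ j ?_ ?_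
  · intro z
    have e : (((z + s : ZMod (Module.finrank K L)).cast : ℤ)) - s ≡ (z.cast : ℤ)
        [ZMOD Module.finrank K L] := by
      rw [← hcast, Int.cast_sub, hz, hz, add_sub_cancel_right]
    rw [map_eq_zero (frobMap K L M k s), map_eq_zero (algebraMap L M), coef_congr hk e]
  · intro c hc
    refine coef_not_proportional hk hs0 hA c fun i => ?_
    have := hc (i : ZMod (Module.finrank K L))
    have hi : (((i : ZMod (Module.finrank K L)).cast : ℤ)) ≡ i [ZMOD Module.finrank K L] := by rw [← hcast, hz]
    rwa [coef_congr hk hi, coef_congr hk (hi.sub_right s)] at this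
  · intro j
    rw [map_eq_zero (fr K _ : M ≃ₐ[K] M), map_eq_zero (fr K _ : M ≃ₐ[K] M),
      add_sub_cancel_right, mul_eq_zero, map_eq_zero (fr K _ : M ≃ₐ[K] M)]
    simp [hη]
  · intro j z h0 h1
    have hpos : 0 < ((Module.finrank K L : ℕ) : ℤ) := by omega
    have hn := Int.emod_nonneg ((z.cast : ℤ) + j) hpos.ne'
    have hlt := Int.emod_lt_of_pos ((z.cast : ℤ) + j) hpos
    have hmod := Int.mod_modEq ((z.cast : ℤ) + j) (Module.finrank K L)
    set v := ((z.cast : ℤ) + j) % Module.finrank K L with hv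
    have hvz : (v : ZMod (Module.finrank K L)) = z + j := by
      rw [(hcast _ _).mpr hmod]
      rw [Int.cast_add, hz]
    have hv0 : v ≠ 0 := fun h => h0 (by rw [← hvz, h]; simp)
    have hv1 : v ≠ 1 := fun h => h1 (by rw [← hvz, h]; simp)
    have hc := coef_twisted hk hkM le_rfl (by omega) (by simpa using h) j (v := v)
      (by push_cast; omega) (by omega)
    have e1 : v - j ≡ (z.cast : ℤ) [ZMOD Module.finrank K L] := by
      have := hmod.sub_right j
      rwa [add_sub_cancel_right] at this
    have e2 : v - (j - (1 - s)) - (1 : ℕ) ≡ (z.cast : ℤ) - s [ZMOD Module.finrank K L] := by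
      have := e1.sub_right s
      convert this using 1
      push_cast
      ring
    rw [coef_congr hk e1, coef_congr hk e2] at hc
    have hc' := congrArg (fr K ((k : ℤ) * j)) hc
    have e3 : ∀ x, fr K ((k : ℤ) * j) (frobMap K L M k j x) = algebraMap L M x := by
      intro x
      rw [frobMap_apply', ← fr_add, neg_mul, add_neg_cancel, fr_zero]
    have e4 : ∀ x, fr K ((k : ℤ) * j) (frobMap K L M k (j - (1 - s) + (1 : ℕ)) x) =
        frobMap K L M k s x := by
      intro x
      rw [frobMap_apply', frobMap_apply', ← fr_add]
      congr 2
      push_cast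
      ring
    rw [map_add, map_mul, map_mul, map_mul, map_zero, e3, e4] at hc'
    rw [map_mul]
    linear_combination hc'
  · have hi' : (((i : ZMod (Module.finrank K L)).cast : ℤ)) ≡ i [ZMOD Module.finrank K L] := by rw [← hcast, hz]
    rw [coef_congr hk hi']
    exact (map_ne_zero _).mpr hi
  · exact (map_ne_zero _).mpr hj

/-- A pair of invertible maps between two twisted codes has opposite monomial-type supports. -/
theorem modEq_zero_of_twistedSpace {s : ℤ} (ht1 : 1 ≤ t) (ht : t + 2 ≤ Module.finrank K L)
    (hs0 : ¬ s ≡ 0 [ZMOD Module.finrank K L]) (hs1 : ¬ s ≡ 1 [ZMOD Module.finrank K L])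
    (hs1' : ¬ s ≡ -1 [ZMOD Module.finrank K L]) (hs2 : ¬ s ≡ 2 [ZMOD Module.finrank K L])
    (hs2' : ¬ s ≡ -2 [ZMOD Module.finrank K L])
    (hη : η = 0 ↔ η' = 0) (hA : Function.Surjective A)
    (h : ∀ φ ∈ twistedSpace hk t η (t - s), G ∘ₗ φ ∘ₗ A ∈ twistedSpace hk t η' (t - s))
    {i j : ℤ} (hi : coef hk i A ≠ 0) (hj : coef hkM j G ≠ 0) :
    i + j ≡ 0 [ZMOD Module.finrank K L] := by
  by_cases h0 : η = 0
  · have h0' := hη.mp h0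
    subst h0 h0'
    exact modEq_zero_of_untwisted hk hkM ht1 ht h hi hj
  · rcases Nat.lt_or_ge t 2 with h2 | h2
    · obtain rfl : t = 1 := by omega
      exact modEq_zero_of_one hk hkM (by omega) hs0 hs1 hs1' hs2 hs2' h0 hA
        (by simpa using h) hi hj
    · exact modEq_zero_of_two_le hk hkM h2 ht hs0 hs1 hs2 (fun h => h0 (hη.mpr h)) h hi hj

end Monomial

/-! ### Linear maps preserving the rank of forms -/

section RankPreservers

open Module

variable {K V W : Type*} [Field K] [AddCommGroup V] [Module K V] [AddCommGroup W] [Module K W]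

/-- The form `(v, w) ↦ u v * y w`, as a bilinear function of `u` and `y`. -/
def pureForm : Dual K V →ₗ[K] Dual K W →ₗ[K] Forms K V W := LinearMap.smulRightₗ

theorem pureForm_apply (u : Dual K V) (y : Dual K W) (v : V) : pureForm u y v = u v • y := rfl

theorem pureForm_eq_zero {u : Dual K V} {y : Dual K W} : pureForm u y = 0 ↔ u = 0 ∨ y = 0 := by
  constructor
  · intro h
    by_contra hcon
    rw [not_or] at hcon
    obtain ⟨v, hv⟩ := DFunLike.ne_iff.mp hcon.1
    have := LinearMap.congr_fun h v
    rw [pureForm_apply] at this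
    exact (smul_ne_zero hv hcon.2) this
  · rintro (rfl | rfl) <;> simp

theorem rank_eq_finrank_range [FiniteDimensional K V] (f : Forms K V W) :
    rank f = finrank K (LinearMap.range f) := by
  have := LinearMap.finrank_range_add_finrank_ker f
  rw [rank]
  omega

theorem exists_smul_eq_of_finrank_range_le_one {X : Type*} [AddCommGroup X] [Module K X]
    [FiniteDimensional K V] (f : V →ₗ[K] X) (h : finrank K (LinearMap.range f) ≤ 1) :
    ∃ y, ∀ v, ∃ c : K, c • y = f v := by
  obtain ⟨y, hy⟩ := ((LinearMap.range f).finrank_le_one_iff_isPrincipal.mp h).principal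
  exact ⟨y, fun v => Submodule.mem_span_singleton.mp (hy ▸ LinearMap.mem_range_self f v)⟩

theorem rank_le_one_iff_exists_pureForm [FiniteDimensional K V] (f : Forms K V W) :
    rank f ≤ 1 ↔ ∃ u y, f = pureForm u y := by
  rw [rank_eq_finrank_range]
  constructor
  · intro h
    obtain ⟨y, hy'⟩ := exists_smul_eq_of_finrank_range_le_one (X := W →ₗ[K] K) f h
    by_cases hy0 : y = 0
    · refine ⟨0, 0, ?_⟩
      ext1 v
      obtain ⟨c, hc⟩ := hy' v
      rw [hy0, smul_zero] at hc
      simpa using hc.symm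
    · obtain ⟨w, hw⟩ := DFunLike.ne_iff.mp hy0
      rw [LinearMap.zero_apply] at hw
      refine ⟨(y w)⁻¹ • (LinearMap.applyₗ w ∘ₗ f), y, ?_⟩
      ext1 v
      obtain ⟨c, hc⟩ := hy' v
      rw [pureForm_apply]
      simp only [LinearMap.smul_apply, LinearMap.comp_apply, LinearMap.applyₗ_apply_apply]
      rw [← hc, LinearMap.smul_apply, smul_eq_mul, smul_eq_mul, mul_left_comm,
        inv_mul_cancel₀ hw, mul_one]
  · rintro ⟨u, y, rfl⟩
    have hle : LinearMap.range (pureForm u y) ≤ Submodule.span K {y} := by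
      rintro _ ⟨v, rfl⟩
      exact Submodule.smul_mem _ _ (Submodule.mem_span_singleton_self y)
    exact (Submodule.finrank_mono hle).trans ((finrank_span_le_card _).trans (by simp))

/-- If p₂ is not a multiple of p, some v has p v = 0 and p₂ v ≠ 0. Evaluating there shows that y₂
vanishes or is parallel to y₃; evaluating where p is nonzero then makes y a nonzero multiple of y₂.
-/
theorem mem_range_of_pureForm_add {p p₂ p₃ : Dual K V} {y y₂ y₃ : Dual K W} (hp : p ≠ 0)
    (hy : y ≠ 0) (h : pureForm p y + pureForm p₂ y₂ = pureForm p₃ y₃) :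
    pureForm p₂ y₂ ∈ LinearMap.range (pureForm (V := V) (W := W) p) ∨
      pureForm p₂ y₂ ∈ LinearMap.range (pureForm (V := V) (W := W).flip y) := by
  have hv : ∀ v, p v • y + p₂ v • y₂ = p₃ v • y₃ := fun v => by
    have := LinearMap.congr_fun h v
    simpa only [LinearMap.add_apply, pureForm_apply] using this
  by_cases hpar : LinearMap.ker p ≤ LinearMap.ker p₂
  · left
    obtain ⟨v₀, hv₀⟩ := DFunLike.ne_iff.mp hp
    rw [LinearMap.zero_apply] at hv₀
    have hp₂ : p₂ = (p₂ v₀ / p v₀) • p := by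
      ext v
      have hk : v - (p v / p v₀) • v₀ ∈ LinearMap.ker p := by
        rw [LinearMap.mem_ker]
        simp [hv₀]
      have := hpar hk
      rw [LinearMap.mem_ker, map_sub, map_smul, smul_eq_mul, sub_eq_zero] at this
      rw [this, LinearMap.smul_apply, smul_eq_mul]
      ring
    refine ⟨(p₂ v₀ / p v₀) • y₂, ?_⟩
    rw [map_smul]
    conv_rhs => rw [hp₂, map_smul, LinearMap.smul_apply]
  · right
    obtain ⟨v, hv1, hv2⟩ := Set.not_subset.mp hpar
    have hv1' : p v = 0 := hv1
    have hv2' : p₂ v ≠ 0 := hv2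
    obtain ⟨v', hv'⟩ := DFunLike.ne_iff.mp hp
    rw [LinearMap.zero_apply] at hv'
    have e1 := hv v
    rw [hv1', zero_smul, zero_add] at e1
    have e2 := hv v'
    have key : ∃ c : K, y₂ = c • y := by
      by_cases h3 : p₃ v = 0
      · rw [h3, zero_smul, smul_eq_zero] at e1
        exact ⟨0, by rw [e1.resolve_left hv2', zero_smul]⟩
      · have e3 : y₃ = (p₂ v / p₃ v) • y₂ := by
          rw [div_eq_inv_mul, mul_smul, e1, inv_smul_smul₀ h3]
        have e4 : y = ((p₃ v' * (p₂ v / p₃ v) - p₂ v') / p v') • y₂ := by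
          rw [e3, ← mul_smul] at e2
          rw [div_eq_inv_mul, mul_smul, sub_smul, ← e2, add_sub_cancel_right, inv_smul_smul₀ hv']
        have hc : (p₃ v' * (p₂ v / p₃ v) - p₂ v') / p v' ≠ 0 := by
          intro h0
          rw [h0, zero_smul] at e4
          exact hy e4
        exact ⟨((p₃ v' * (p₂ v / p₃ v) - p₂ v') / p v')⁻¹, by
          conv_rhs => rw [e4]
          rw [inv_smul_smul₀ hc]⟩
    obtain ⟨c, hc⟩ := key
    refine ⟨c • p₂, ?_⟩
    rw [LinearMap.flip_apply, map_smul, LinearMap.smul_apply, ← map_smul, ← hc]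

theorem eq_top_or_eq_top_of_forall_mem_or {X : Type*} [AddCommGroup X] [Module K X]
    (P Q : Submodule K X) (h : ∀ x, x ∈ P ∨ x ∈ Q) : P = ⊤ ∨ Q = ⊤ := by
  by_contra hcon
  rw [not_or, Submodule.eq_top_iff', Submodule.eq_top_iff'] at hcon
  push Not at hcon
  obtain ⟨⟨a, ha⟩, b, hb⟩ := hcon
  have ha' := (h a).resolve_left ha
  have hb' := (h b).resolve_right hb
  rcases h (a + b) with h1 | h1
  · exact ha ((Submodule.add_mem_iff_left P hb').mp h1)
  · exact hb ((Submodule.add_mem_iff_right Q ha').mp h1)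

/-- A linear family of forms of rank at most one has a common left or a common right factor. -/
theorem common_factor {X : Type*} [AddCommGroup X] [Module K X] [FiniteDimensional K V]
    (S : X →ₗ[K] Forms K V W) (hS : ∀ x, rank (S x) ≤ 1) {p : Dual K V} {y : Dual K W}
    (hp : p ≠ 0) (hy : y ≠ 0) {x₀ : X} (hx₀ : S x₀ = pureForm p y) :
    LinearMap.range S ≤ LinearMap.range (pureForm (V := V) (W := W) p) ∨
      LinearMap.range S ≤ LinearMap.range (pureForm (V := V) (W := W).flip y) := by
  have h := eq_top_or_eq_top_of_forall_mem_or
    ((LinearMap.range (pureForm (V := V) (W := W) p)).comap S)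
    ((LinearMap.range (pureForm (V := V) (W := W).flip y)).comap S) (fun x => by
      obtain ⟨p₂, y₂, h2⟩ := (rank_le_one_iff_exists_pureForm _).mp (hS x)
      obtain ⟨p₃, y₃, h3⟩ := (rank_le_one_iff_exists_pureForm _).mp (hS (x₀ + x))
      rw [map_add, hx₀, h2] at h3
      rw [Submodule.mem_comap, Submodule.mem_comap, h2]
      exact mem_range_of_pureForm_add hp hy h3)
  refine h.imp (fun h => ?_) (fun h => ?_)
  all_goals
    rintro _ ⟨x, rfl⟩
    have : x ∈ (⊤ : Submodule K X) := Submodule.mem_top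
    rw [← h] at this
    exact this

theorem pureForm_injective {u : Dual K V} (hu : u ≠ 0) :
    Function.Injective (pureForm (V := V) (W := W) u) := by
  refine (injective_iff_map_eq_zero _).mpr fun y hy => ?_
  exact (pureForm_eq_zero.mp hy).resolve_left hu

theorem pureForm_flip_injective {y : Dual K W} (hy : y ≠ 0) :
    Function.Injective (pureForm (V := V) (W := W).flip y) := by
  refine (injective_iff_map_eq_zero _).mpr fun u hu => ?_
  exact (pureForm_eq_zero.mp hu).resolve_right hy

variable [FiniteDimensional K V] [FiniteDimensional K W]

/-- A linear map of the dual space is the transpose of a linear map. -/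
theorem exists_dualMap_eq (S : Dual K V →ₗ[K] Dual K V) (hS : Function.Injective S) :
    ∃ g : V ≃ₗ[K] V, ∀ u v, S u v = u (g v) := by
  have hS' : Function.Surjective S := LinearMap.surjective_of_injective hS
  let g : V →ₗ[K] V := (evalEquiv K V).symm.toLinearMap ∘ₗ S.dualMap ∘ₗ Dual.eval K V
  have hg : ∀ u v, S u v = u (g v) := fun u v => by
    simp [g]
  have hinj : Function.Injective g := by
    rw [← LinearMap.ker_eq_bot, LinearMap.ker_eq_bot']
    intro v hv
    rw [← forall_dual_apply_eq_zero_iff K v]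
    intro u
    obtain ⟨u, rfl⟩ := hS' u
    rw [hg, hv, map_zero]
  exact ⟨LinearEquiv.ofInjectiveEndo g hinj, hg⟩

/-- A linear bijection that preserves the rank of forms on `V × W`, where `dim V < dim W`, is
induced by an element of `GL(V) × GL(W)`. -/
theorem exists_eq_pull_of_rank_preserving (hV : 1 < finrank K V) (hVW : finrank K V < finrank K W)
    (T : Forms K V W ≃ₗ[K] Forms K V W) (hT : ∀ f, rank (T f) = rank f) :
    ∃ (g : V ≃ₗ[K] V) (g' : W ≃ₗ[K] W), ∀ f v w, T f v w = f (g v) (g' w) := by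
  have hone : ∀ u y, rank (T (pureForm u y)) ≤ 1 := fun u y => by
    rw [hT, rank_le_one_iff_exists_pureForm]
    exact ⟨u, y, rfl⟩
  have hVn : Nontrivial V := nontrivial_of_finrank_pos (R := K) (by omega)
  have hWn : Nontrivial W := nontrivial_of_finrank_pos (R := K) (by omega)
  have hdV : finrank K (Dual K V) = finrank K V := Subspace.dual_finrank_eq
  have hdW : finrank K (Dual K W) = finrank K W := Subspace.dual_finrank_eq
  have hDV : Nontrivial (Dual K V) := nontrivial_of_finrank_pos (R := K) (by omega)
  have hDW : Nontrivial (Dual K W) := nontrivial_of_finrank_pos (R := K) (by omega)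
  have hne : ∀ {u : Dual K V} {y : Dual K W}, u ≠ 0 → y ≠ 0 → T (pureForm u y) ≠ 0 := by
    intro u y hu hy h
    rw [LinearEquiv.map_eq_zero_iff, pureForm_eq_zero] at h
    exact h.elim hu hy
  have hpure : ∀ u y, ∃ p z, T (pureForm u y) = pureForm p z := fun u y =>
    (rank_le_one_iff_exists_pureForm _).mp (hone u y)
  obtain ⟨y₀, hy₀⟩ := exists_ne (0 : Dual K W)
  -- a common left factor of the images of the forms with a given left factor
  have hleft : ∀ u : Dual K V, u ≠ 0 → ∃ p : Dual K V, p ≠ 0 ∧ ∃ Q : Dual K W →ₗ[K] Dual K W,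
      ∀ y, T (pureForm u y) = pureForm p (Q y) := by
    intro u hu
    obtain ⟨p, z, hpz⟩ := hpure u y₀
    have h0 := hne hu hy₀
    rw [hpz, Ne, pureForm_eq_zero, not_or] at h0
    have hinj : Function.Injective (T.toLinearMap ∘ₗ pureForm (V := V) (W := W) u) :=
      T.injective.comp (pureForm_injective hu)
    rcases common_factor (T.toLinearMap ∘ₗ pureForm u) (hone u) h0.1 h0.2 hpz with h | h
    · obtain ⟨v, hv⟩ := DFunLike.ne_iff.mp h0.1
      rw [LinearMap.zero_apply] at hv
      refine ⟨p, h0.1, (p v)⁻¹ • (LinearMap.applyₗ v ∘ₗ T.toLinearMap ∘ₗ pureForm u), fun y => ?_⟩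
      obtain ⟨z', hz'⟩ := h ⟨y, rfl⟩
      have hz'' : T (pureForm u y) = pureForm p z' := hz'.symm
      simp only [LinearMap.smul_apply, LinearMap.comp_apply, LinearMap.applyₗ_apply_apply,
        LinearEquiv.coe_coe]
      rw [hz'', pureForm_apply, inv_smul_smul₀ hv]
    -- A common right factor would embed a space of dimension dim W into one of dimension dim V.
    · exfalso
      have h1 := Submodule.finrank_mono h
      rw [LinearMap.finrank_range_of_inj hinj,
        LinearMap.finrank_range_of_inj (pureForm_flip_injective h0.2)] at h1
      omega
  obtain ⟨u₀, hu₀⟩ := exists_ne (0 : Dual K V)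
  obtain ⟨p₀, hp₀, R, hR⟩ := hleft u₀ hu₀
  have hRinj : Function.Injective R := by
    rw [← LinearMap.ker_eq_bot, LinearMap.ker_eq_bot']
    intro y hy
    by_contra hy'
    refine hne hu₀ hy' ?_
    rw [hR, hy, map_zero]
  -- a common right factor
  have hright : ∀ y u, ∃ p, T (pureForm u y) = pureForm p (R y) := by
    intro y u
    by_cases hy : y = 0
    · exact ⟨0, by simp [hy]⟩
    have hRy : R y ≠ 0 := fun h => hy (hRinj (by rw [h, map_zero]))
    rcases common_factor (T.toLinearMap ∘ₗ pureForm.flip y) (fun u => hone u y) hp₀ hRy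
      (hR y) with h | h
    -- If all images had left factor p₀, each would also be the image of a form with left factor u₀.
    -- By injectivity of T every u would be a multiple of u₀, against dim V > 1.
    · exfalso
      have hsub : LinearMap.range (pureForm (V := V) (W := W).flip y) ≤
          LinearMap.range (pureForm (V := V) (W := W) u₀) := by
        rintro _ ⟨u, rfl⟩
        obtain ⟨z, hz⟩ := h ⟨u, rfl⟩
        obtain ⟨z, rfl⟩ := LinearMap.surjective_of_injective hRinj z
        rw [← hR] at hz
        exact ⟨z, T.injective hz⟩
      have hspan : (⊤ : Submodule K (Dual K V)) ≤ Submodule.span K {u₀} := by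
        intro u _
        obtain ⟨z, hz⟩ := hsub ⟨u, rfl⟩
        obtain ⟨w, hw⟩ := DFunLike.ne_iff.mp hy
        rw [LinearMap.zero_apply] at hw
        rw [Submodule.mem_span_singleton]
        refine ⟨z w / y w, ?_⟩
        ext v
        have := LinearMap.congr_fun (LinearMap.congr_fun hz v) w
        rw [LinearMap.flip_apply, pureForm_apply, pureForm_apply] at this
        simp only [LinearMap.smul_apply, smul_eq_mul] at this ⊢
        field_simp
        linear_combination this
      have := Submodule.finrank_mono hspan
      rw [finrank_top] at this
      have := this.trans ((finrank_span_le_card _).trans (by simp) : _ ≤ 1)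
      omega
    · obtain ⟨p, hp⟩ := h ⟨u, rfl⟩
      exact ⟨p, hp.symm⟩
  have hboth : ∀ u, ∃ p, ∀ y, T (pureForm u y) = pureForm p (R y) := by
    intro u
    by_cases hu : u = 0
    · exact ⟨0, by simp [hu]⟩
    obtain ⟨p, hp, Q, hQ⟩ := hleft u hu
    let e := LinearEquiv.ofInjectiveEndo R hRinj
    -- Comparing left and right factors, Q R⁻¹ sends every vector to a multiple of itself, hence is
    -- a scalar.
    obtain ⟨c, hc⟩ := LinearMap.exists_eq_smul_id_of_forall_notLinearIndependent
      (f := Q ∘ₗ e.symm.toLinearMap) (by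
        intro z hli
        obtain ⟨p', hp'⟩ := hright (e.symm z) u
        have hz : R (e.symm z) = z := e.apply_symm_apply z
        rw [hQ, hz] at hp'
        obtain ⟨v, hv⟩ := DFunLike.ne_iff.mp hp
        rw [LinearMap.zero_apply] at hv
        have h1 := LinearMap.congr_fun hp' v
        rw [pureForm_apply, pureForm_apply] at h1
        rw [LinearIndependent.pair_iff] at hli
        have := hli (p' v) (-(p v)) (by
          rw [← h1]
          simp)
        exact hv (neg_eq_zero.mp this.2))
    refine ⟨c • p, fun y => ?_⟩
    have h2 : Q y = c • R y := by
      have := LinearMap.congr_fun hc (R y)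
      have he : e.symm (R y) = y := e.symm_apply_apply y
      simpa [he] using this
    rw [hQ, h2, map_smul, map_smul, LinearMap.smul_apply]
  -- the left factor is a linear function
  obtain ⟨w₀, hw₀⟩ : ∃ w, R y₀ w ≠ 0 := by
    have : R y₀ ≠ 0 := fun h => hy₀ (hRinj (by rw [h, map_zero]))
    exact DFunLike.ne_iff.mp this
  let S : Dual K V →ₗ[K] Dual K V :=
    { toFun := fun u => (R y₀ w₀)⁻¹ • ((T (pureForm u y₀)).flip w₀)
      map_add' := fun u u' => by
        ext v
        simp [mul_add]
      map_smul' := fun c u => by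
        ext v
        simp [mul_left_comm] }
  have hS : ∀ u y, T (pureForm u y) = pureForm (S u) (R y) := by
    intro u y
    obtain ⟨p, hp⟩ := hboth u
    have : S u = p := by
      ext v
      change (R y₀ w₀)⁻¹ • (T (pureForm u y₀) v w₀) = p v
      rw [hp, pureForm_apply, LinearMap.smul_apply, smul_eq_mul, smul_eq_mul]
      field_simp
    rw [this, hp]
  have hSinj : Function.Injective S := by
    rw [← LinearMap.ker_eq_bot, LinearMap.ker_eq_bot']
    intro u hu
    by_contra hu'
    refine hne hu' hy₀ ?_
    rw [hS, hu, map_zero, LinearMap.zero_apply]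
  obtain ⟨g, hg⟩ := exists_dualMap_eq S hSinj
  obtain ⟨g', hg'⟩ := exists_dualMap_eq R hRinj
  refine ⟨g, g', fun f v w => ?_⟩
  let b := finBasis K V
  have hf : f = ∑ i, pureForm (b.coord i) (f (b i)) := by
    ext1 v
    rw [LinearMap.sum_apply]
    conv_lhs => rw [← b.sum_repr v, map_sum]
    refine Finset.sum_congr rfl fun i _ => ?_
    rw [map_smul, pureForm_apply, Basis.coord_apply]
  have h1 : T f v w = ∑ i, b.coord i (g v) * f (b i) (g' w) := by
    conv_lhs => rw [hf]
    rw [map_sum, LinearMap.sum_apply, LinearMap.sum_apply]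
    refine Finset.sum_congr rfl fun i _ => ?_
    rw [hS, pureForm_apply, LinearMap.smul_apply, smul_eq_mul, hg, hg']
  have h2 : f (g v) (g' w) = ∑ i, b.coord i (g v) * f (b i) (g' w) := by
    conv_lhs => rw [hf]
    rw [LinearMap.sum_apply, LinearMap.sum_apply]
    rfl
  rw [h1, h2]

end RankPreservers

/-! ### Transformations of forms induced by semilinear pairs over K -/

section SemilinearPairs

variable {K V V' : Type*} [Field K] [AddCommGroup V] [Module K V] [AddCommGroup V'] [Module K V']

theorem semiPull_apply (σ : K ≃+* K) (g : V ≃+ V) (g' : V' ≃+ V')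
    (hg : ∀ (c : K) v, g (c • v) = σ.symm c • g v)
    (hg' : ∀ (c : K) v, g' (c • v) = σ.symm c • g' v) (f : Forms K V V') (v : V) (v' : V') :
    semiPull σ g g' hg hg' f v v' = σ (f (g v) (g' v')) := rfl

theorem pull_apply (g : V ≃ₗ[K] V) (g' : V' ≃ₗ[K] V') (f : Forms K V V') (v : V) (v' : V') :
    pull g g' f v v' = f (g v) (g' v') := rfl

/-- `τ` is the transformation `f ↦ ((v, v') ↦ σ (f (g v) (g' v')))` for some bijective
`σ⁻¹`-semilinear maps `g` and `g'`. -/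
def IsSemiPull (σ : K ≃+* K) (τ : Equiv.Perm (Forms K V V')) : Prop :=
  ∃ (g : V ≃+ V) (g' : V' ≃+ V') (hg : ∀ (c : K) v, g (c • v) = σ.symm c • g v)
    (hg' : ∀ (c : K) v, g' (c • v) = σ.symm c • g' v), τ = semiPull σ g g' hg hg'

theorem IsSemiPull.mul {σ ρ : K ≃+* K} {τ υ : Equiv.Perm (Forms K V V')}
    (hτ : IsSemiPull σ τ) (hυ : IsSemiPull ρ υ) : IsSemiPull (σ * ρ) (τ * υ) := by
  obtain ⟨g₁, g₁', h₁, h₁', rfl⟩ := hτ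
  obtain ⟨g₂, g₂', h₂, h₂', rfl⟩ := hυ
  refine ⟨g₁.trans g₂, g₁'.trans g₂', fun c v => ?_, fun c v => ?_, ?_⟩
  · simp only [AddEquiv.trans_apply, h₁, h₂]
    rfl
  · simp only [AddEquiv.trans_apply, h₁', h₂']
    rfl
  · rfl

theorem isSemiPull_one : IsSemiPull (1 : K ≃+* K) (1 : Equiv.Perm (Forms K V V')) :=
  ⟨AddEquiv.refl V, AddEquiv.refl V', fun _ _ => rfl, fun _ _ => rfl, rfl⟩

theorem IsSemiPull.pow {σ : K ≃+* K} {τ : Equiv.Perm (Forms K V V')} (hτ : IsSemiPull σ τ)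
    (n : ℕ) : IsSemiPull (σ ^ n) (τ ^ n) := by
  induction n with
  | zero => simpa using isSemiPull_one
  | succ n ih => rw [pow_succ, pow_succ]; exact ih.mul hτ

theorem IsSemiPull.inv {σ : K ≃+* K} {τ : Equiv.Perm (Forms K V V')} (hτ : IsSemiPull σ τ) :
    IsSemiPull σ⁻¹ τ⁻¹ := by
  obtain ⟨g, g', h, h', rfl⟩ := hτ
  refine ⟨g.symm, g'.symm, fun c v => ?_, fun c v => ?_, ?_⟩
  · apply g.injective
    rw [h]
    simp only [AddEquiv.apply_symm_apply]
    exact congrArg (· • v) (σ.symm_apply_apply c).symm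
  · apply g'.injective
    rw [h']
    simp only [AddEquiv.apply_symm_apply]
    exact congrArg (· • v) (σ.symm_apply_apply c).symm
  · rfl

theorem IsSemiPull.exists_eq_pull {τ : Equiv.Perm (Forms K V V')} (hτ : IsSemiPull 1 τ) :
    ∃ (A : V ≃ₗ[K] V) (B : V' ≃ₗ[K] V'), τ = pull A B := by
  obtain ⟨g, g', h, h', rfl⟩ := hτ
  exact ⟨g.toLinearEquiv h, g'.toLinearEquiv h', rfl⟩

theorem isSemiPull_pull (A : V ≃ₗ[K] V) (B : V' ≃ₗ[K] V') : IsSemiPull 1 (pull A B) :=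
  ⟨A.toAddEquiv, B.toAddEquiv, fun c v => A.map_smul c v, fun c v => B.map_smul c v, rfl⟩

theorem IsSemiPull.map_smul {σ : K ≃+* K} {τ : Equiv.Perm (Forms K V V')} (hτ : IsSemiPull σ τ)
    (c : K) (f : Forms K V V') : τ (c • f) = σ c • τ f := by
  obtain ⟨g, g', h, h', rfl⟩ := hτ
  refine LinearMap.ext fun v => LinearMap.ext fun v' => ?_
  rw [LinearMap.smul_apply, LinearMap.smul_apply, semiPull_apply, semiPull_apply]
  simp

theorem IsSemiPull.mem_rankAut [Finite K] [Finite V] {σ : K ≃+* K}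
    {τ : Equiv.Perm (Forms K V V')} (hτ : IsSemiPull σ τ) : τ ∈ rankAut K V V' := by
  have hsm := hτ.map_smul
  obtain ⟨g, g', h, h', rfl⟩ := hτ
  refine ⟨⟨fun f₁ f₂ => ?_, σ, hsm⟩, fun f => ?_⟩
  · refine LinearMap.ext fun v => LinearMap.ext fun v' => ?_
    rw [LinearMap.add_apply, LinearMap.add_apply, semiPull_apply, semiPull_apply, semiPull_apply]
    simp
  · have hker : ∀ v, v ∈ LinearMap.ker (semiPull σ g g' h h' f) ↔ g v ∈ LinearMap.ker f := by
      intro v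
      rw [LinearMap.mem_ker, LinearMap.mem_ker]
      constructor
      · intro hv
        refine LinearMap.ext fun v' => ?_
        have := LinearMap.congr_fun hv (g'.symm v')
        rw [semiPull_apply, AddEquiv.apply_symm_apply] at this
        simpa using this
      · intro hv
        refine LinearMap.ext fun v' => ?_
        rw [semiPull_apply, hv]
        simp
    -- The bijection g between the left radicals is only semilinear, so their dimensions are
    -- compared by counting elements over the finite field K.
    have hcard : Nat.card (LinearMap.ker (semiPull σ g g' h h' f)) =
        Nat.card (LinearMap.ker f) :=
      Nat.card_congr (g.toEquiv.subtypeEquiv hker)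
    rw [Module.natCard_eq_pow_finrank (K := K),
      Module.natCard_eq_pow_finrank (K := K) (V := ↥(LinearMap.ker f))] at hcard
    have := Nat.pow_right_injective (Finite.one_lt_card (α := K)) hcard
    rw [rank, rank, this]

end SemilinearPairs

/-! ### Pairs that are semilinear over L -/

section Normalizer

variable {K L M : Type*} [Field K] [Field L] [Field M] [Algebra K L] [Algebra K M] [Algebra L M]

/-- `τ` is induced by a pair of maps that are `θ`-semilinear over `L`. -/
def IsSemiPullOver (θ : L ≃+* L) (τ : Equiv.Perm (Forms K L M)) : Prop :=
  ∃ (σ : K ≃+* K) (g : L ≃+ L) (g' : M ≃+ M) (hg : ∀ (c : K) v, g (c • v) = σ.symm c • g v)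
    (hg' : ∀ (c : K) v, g' (c • v) = σ.symm c • g' v), τ = semiPull σ g g' hg hg' ∧
      (∀ x y : L, g (x * y) = θ x * g y) ∧ ∀ (x : L) (y : M), g' (x • y) = θ x • g' y

/-- The order is reversed because the maps act on the arguments of the forms, that is,
contravariantly. -/
theorem IsSemiPullOver.mul {θ κ : L ≃+* L} {τ υ : Equiv.Perm (Forms K L M)}
    (hτ : IsSemiPullOver θ τ) (hυ : IsSemiPullOver κ υ) : IsSemiPullOver (κ * θ) (τ * υ) := by
  obtain ⟨σ, g₁, g₁', h₁, h₁', rfl, a₁, b₁⟩ := hτ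
  obtain ⟨ρ, g₂, g₂', h₂, h₂', rfl, a₂, b₂⟩ := hυ
  refine ⟨σ * ρ, g₁.trans g₂, g₁'.trans g₂', fun c v => ?_, fun c v => ?_, rfl, fun x y => ?_,
    fun x y => ?_⟩
  · simp only [AddEquiv.trans_apply, h₁, h₂]
    rfl
  · simp only [AddEquiv.trans_apply, h₁', h₂']
    rfl
  · simp only [AddEquiv.trans_apply, a₁, a₂]
    rfl
  · simp only [AddEquiv.trans_apply, b₁, b₂]
    rfl

theorem isSemiPullOver_one : IsSemiPullOver (1 : L ≃+* L) (1 : Equiv.Perm (Forms K L M)) :=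
  ⟨1, AddEquiv.refl L, AddEquiv.refl M, fun _ _ => rfl, fun _ _ => rfl, rfl, fun _ _ => rfl,
    fun _ _ => rfl⟩

theorem IsSemiPullOver.inv {θ : L ≃+* L} {τ : Equiv.Perm (Forms K L M)}
    (hτ : IsSemiPullOver θ τ) : IsSemiPullOver θ⁻¹ τ⁻¹ := by
  obtain ⟨σ, g, g', h, h', rfl, a, b⟩ := hτ
  have hθ : ∀ x, θ (θ⁻¹ x) = x := θ.apply_symm_apply
  refine ⟨σ⁻¹, g.symm, g'.symm, fun c v => ?_, fun c v => ?_, rfl, fun x y => ?_, fun x y => ?_⟩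
  · apply g.injective
    rw [h]
    simp only [AddEquiv.apply_symm_apply]
    exact congrArg (· • v) (σ.symm_apply_apply c).symm
  · apply g'.injective
    rw [h']
    simp only [AddEquiv.apply_symm_apply]
    exact congrArg (· • v) (σ.symm_apply_apply c).symm
  · apply g.injective
    rw [a, hθ]
    simp
  · apply g'.injective
    rw [b, hθ]
    simp

theorem IsSemiPullOver.pow {θ : L ≃+* L} {τ : Equiv.Perm (Forms K L M)}
    (hτ : IsSemiPullOver θ τ) (n : ℕ) : IsSemiPullOver (θ ^ n) (τ ^ n) := by
  induction n with
  | zero => simpa using isSemiPullOver_one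
  | succ n ih => rw [pow_succ', pow_succ]; exact ih.mul hτ

theorem isSemiPullOver_pull {θ : L ≃+* L} {A : L ≃ₗ[K] L} {B : M ≃ₗ[K] M}
    (hA : ∀ x y : L, A (x * y) = θ x * A y) (hB : ∀ (x : L) (y : M), B (x • y) = θ x • B y) :
    IsSemiPullOver θ (pull A B) :=
  ⟨1, A.toAddEquiv, B.toAddEquiv, fun c v => A.map_smul c v, fun c v => B.map_smul c v, rfl, hA,
    hB⟩

/-- L-linearity contains K-linearity: computing g(c · 1) in both ways forces σ = 1, and an L-linear
map of L is multiplication by its value at 1. -/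
theorem IsSemiPullOver.exists_eq_pull {τ : Equiv.Perm (Forms K L M)} (hτ : IsSemiPullOver 1 τ) :
    ∃ (A : L ≃ₗ[K] L) (B : M ≃ₗ[K] M), τ = pull A B ∧ (∀ x, A x = A 1 * x) ∧
      ∀ (x : L) (y : M), B (x • y) = x • B y := by
  obtain ⟨σ, g, g', h, h', rfl, a, b⟩ := hτ
  have hσ : ∀ c, σ.symm c = c := by
    intro c
    have h1 := h c 1
    rw [Algebra.smul_def, a] at h1
    have hne : g 1 ≠ 0 := by simp
    have h2 : algebraMap K L c * g 1 = algebraMap K L (σ.symm c) * g 1 := by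
      rw [← Algebra.smul_def (σ.symm c)]
      exact h1
    exact (algebraMap K L).injective (mul_right_cancel₀ hne h2).symm
  obtain rfl : σ = 1 := by
    ext c
    have := hσ (σ c)
    rw [RingEquiv.symm_apply_apply] at this
    exact this.symm
  refine ⟨g.toLinearEquiv h, g'.toLinearEquiv h', rfl, fun x => ?_, b⟩
  have := a x 1
  rw [mul_one] at this
  change g x = g 1 * x
  rw [this, mul_comm]
  rfl

variable [Fintype K] [Finite L] [Finite M]

theorem isSemiPullOver_shift [IsScalarTower K L M] (k : ℕ) :
    IsSemiPullOver (fr K (-(k : ℤ)) : L ≃ₐ[K] L).toRingEquiv (shift K L M k) := by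
  refine isSemiPullOver_pull (fun x y => map_mul (fr K _ : L ≃ₐ[K] L) _ _) (fun x y => ?_)
  simp only [Algebra.smul_def, AlgEquiv.toLinearEquiv_apply, map_mul]
  congr 1
  exact (fr_algebraMap K _ x).symm

end Normalizer

/-! ### Automorphisms of L as powers of Frobenius -/

section FrobeniusPowers

variable {K L M : Type*} [Field K] [Fintype K] [Field L] [Finite L] [Field M] [Finite M]
  [Algebra K L] [Algebra K M]

variable (p : ℕ) [Fact p.Prime] [CharP L p]

theorem frobeniusEquiv_pow_apply (n : ℕ) (x : L) : (frobeniusEquiv L p ^ n) x = x ^ p ^ n := by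
  induction n with
  | zero => simp
  | succ n ih =>
    rw [pow_succ']
    change frobeniusEquiv L p ((frobeniusEquiv L p ^ n) x) = _
    rw [ih, frobeniusEquiv_apply, frobenius_def, ← pow_mul, pow_succ]

/-- Every automorphism fixes the prime field, so it lies in the cyclic Galois group over it. -/
theorem exists_eq_frobeniusEquiv_pow (θ : L ≃+* L) : ∃ f : ℕ, θ = frobeniusEquiv L p ^ f := by
  let _ := ZMod.algebra L p
  let θ' : L ≃ₐ[ZMod p] L := AlgEquiv.ofRingEquiv (f := θ) (fun c => by
    have : (θ : L →+* L).comp (algebraMap (ZMod p) L) = algebraMap (ZMod p) L :=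
      Subsingleton.elim _ _
    exact RingHom.congr_fun this c)
  obtain ⟨f, hf⟩ := (FiniteField.bijective_frobeniusAlgEquivOfAlgebraic_pow (ZMod p) L).2 θ'
  refine ⟨f, RingEquiv.ext fun x => ?_⟩
  have h1 : θ x = θ' x := rfl
  rw [h1, ← hf, frobeniusEquiv_pow_apply]
  simp only [AlgEquiv.coe_pow, FiniteField.coe_frobeniusAlgEquivOfAlgebraic_iterate, ZMod.card]

theorem fr_toRingEquiv {h : ℕ} (hq : Fintype.card K = p ^ h) (j : ℤ) :
    (fr K j : L ≃ₐ[K] L).toRingEquiv = frobeniusEquiv L p ^ ((h : ℤ) * j) := by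
  have hn : ∀ n : ℕ, (fr K (n : ℤ) : L ≃ₐ[K] L).toRingEquiv = frobeniusEquiv L p ^ (h * n) := by
    intro n
    ext x
    rw [frobeniusEquiv_pow_apply]
    change fr K (n : ℤ) x = _
    rw [fr_natCast, hq, pow_mul]
  obtain ⟨n, rfl | rfl⟩ := j.eq_nat_or_neg
  · rw [hn]
    exact_mod_cast rfl
  · have := hn n
    rw [mul_neg, zpow_neg, show (h : ℤ) * n = ((h * n : ℕ) : ℤ) by push_cast; ring, zpow_natCast,
      ← this, ← fr_symm]
    rfl

/-- Every automorphism of `L` is, up to the Galois group of `L` over `K`, a small power of the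
Frobenius automorphism. -/
theorem exists_exponents {h m k : ℕ} (hq : Fintype.card K = p ^ h) (hh : 0 < h) (hm0 : 0 < m)
    (hm : Module.finrank K L = m) (hk : Nat.Coprime k m) (θ : L ≃+* L) :
    ∃ i e : ℕ, i < m ∧ e < h ∧
      θ = (fr K (-(k : ℤ)) : L ≃ₐ[K] L).toRingEquiv ^ i * (frobeniusEquiv L p)⁻¹ ^ e := by
  obtain ⟨f, rfl⟩ := exists_eq_frobeniusEquiv_pow p θ
  have hhz : (0 : ℤ) < h := by exact_mod_cast hh
  have hmz : (0 : ℤ) < m := by exact_mod_cast hm0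
  -- The sign is due to φ and ℓ acting on arguments by inverse Frobenius maps. Writing -f = e + h w,
  -- the exponent i must solve k i ≡ w mod m, so it is the residue of c w with c inverse to k.
  obtain ⟨e, he⟩ := Int.eq_ofNat_of_zero_le (Int.emod_nonneg (-(f : ℤ)) hhz.ne')
  have hlt := Int.emod_lt_of_pos (-(f : ℤ)) hhz
  have hdiv := Int.mul_ediv_add_emod (-(f : ℤ)) h
  set w := -(f : ℤ) / h with hw
  obtain ⟨c, d, hcd⟩ := Nat.isCoprime_iff_coprime.mpr hk
  obtain ⟨i, hi⟩ := Int.eq_ofNat_of_zero_le (Int.emod_nonneg (c * w) hmz.ne')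
  have hlt' := Int.emod_lt_of_pos (c * w) hmz
  have hdiv' := Int.mul_ediv_add_emod (c * w) m
  refine ⟨i, e, by omega, by omega, ?_⟩
  have hord : frobeniusEquiv L p ^ ((h : ℤ) * m) = 1 := by
    rw [← fr_toRingEquiv p hq, ← hm, (fr_eq_iff K (F := L) _ 0).mpr (by simp [Int.ModEq])]
    ext x
    exact fr_zero K x
  have key : frobeniusEquiv L p ^ ((f : ℤ) + ((h : ℤ) * m) * (d * w + k * (c * w / m))) =
      frobeniusEquiv L p ^ ((h : ℤ) * (-(k : ℤ)) * i - e) := by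
    congr 1
    rw [hi] at hdiv'
    rw [he] at hdiv
    linear_combination (h : ℤ) * k * hdiv' + hdiv + h * w * hcd
  rw [zpow_add, zpow_mul _ ((h : ℤ) * m), hord, one_zpow, mul_one, zpow_natCast] at key
  rw [key, fr_toRingEquiv p hq, ← zpow_natCast, ← zpow_natCast, ← zpow_mul, inv_zpow, ← zpow_neg,
    ← zpow_add, sub_eq_add_neg]

variable [CharP K p] [CharP M p]

theorem frobForms_apply (f : Forms K L M) (x : L) (y : M) :
    frobForms K L M p f x y =
      frobeniusEquiv K p (f ((frobeniusEquiv L p).symm x) ((frobeniusEquiv M p).symm y)) := rfl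

theorem isSemiPull_frobForms : IsSemiPull (frobeniusEquiv K p) (frobForms K L M p) :=
  ⟨_, _, _, _, rfl⟩

theorem isSemiPullOver_frobForms [Algebra L M] :
    IsSemiPullOver (frobeniusEquiv L p)⁻¹ (frobForms K L M p) := by
  refine ⟨_, _, _, _, _, rfl,
    fun x y => map_mul (frobeniusEquiv L p).symm _ _, fun x y => ?_⟩
  apply (frobeniusEquiv M p).injective
  obtain ⟨x, rfl⟩ := (frobeniusEquiv L p).surjective x
  have e : (frobeniusEquiv L p)⁻¹ (frobeniusEquiv L p x) = x :=
    (frobeniusEquiv L p).symm_apply_apply x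
  rw [e]
  simp [Algebra.smul_def, frobenius_def, mul_pow]

end FrobeniusPowers

/-! ### Circulant matrices and coefficients -/

section Circulant

variable {K F : Type*} [Field K] [Fintype K] [Field F] [Finite F] [Algebra K F]

/-- Row i of the matrix identity is row 0 with x ↦ x^{[ki]} applied, so row 0 carries all the
information. -/
theorem isMatrixOf_iff_forall_sum {k : ℕ} (b : Fin (Module.finrank K F) → F) (B : F ≃ₗ[K] F) :
    IsMatrixOf K k b B ↔ ∀ x, B x = ∑ j, b j * fr K ((k : ℤ) * (j : ℕ)) x := by
  have hpos : 0 < Module.finrank K F := Module.finrank_pos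
  have : NeZero (Module.finrank K F) := ⟨hpos.ne'⟩
  refine forall_congr' fun x => ?_
  have hrow : ∀ i, (circulant K k b).mulVec (cyc K k x) i =
      fr K ((k : ℤ) * (i : ℕ)) (∑ j, b j * fr K ((k : ℤ) * (j : ℕ)) x) := by
    intro i
    simp only [Matrix.mulVec, dotProduct, circulant, cyc, Matrix.of_apply]
    rw [← Equiv.sum_comp (Equiv.addRight i), map_sum]
    refine Finset.sum_congr rfl fun j _ => ?_
    rw [Equiv.coe_addRight, add_sub_cancel_right, map_mul, ← fr_add]
    congr 1
    refine congrArg (fun e : F ≃ₐ[K] F => e x) ((fr_eq_iff K _ _).mpr ?_)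
    rw [← mul_add]
    refine Int.ModEq.mul_left _ ?_
    rw [Fin.val_add]
    push_cast
    rw [add_comm ((i : ℕ) : ℤ)]
    exact Int.mod_modEq _ _
  constructor
  · intro h
    have h0 := congrFun h 0
    rw [hrow] at h0
    simpa [cyc, fr_zero] using h0.symm
  · intro h
    funext i
    rw [hrow, ← h]
    rfl

theorem isMatrixOf_singleArray_iff {k : ℕ} (a : F) (A : F ≃ₗ[K] F) :
    IsMatrixOf K k (singleArray K a) A ↔ ∀ x, A x = a * x := by
  have hpos : 0 < Module.finrank K F := Module.finrank_pos
  rw [isMatrixOf_iff_forall_sum]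
  refine forall_congr' fun x => ?_
  rw [Finset.sum_eq_single ⟨0, hpos⟩]
  · simp [singleArray, fr_zero]
  · intro j _ hj
    rw [singleArray, if_neg (fun h => hj (Fin.ext h)), zero_mul]
  · simp

theorem sum_neg_of_periodic {A : Type*} [AddCommMonoid A] {m : ℕ} (hm : 0 < m) (f : ℤ → A)
    (hf : ∀ i j : ℤ, i ≡ j [ZMOD m] → f i = f j) :
    ∑ i : Fin m, f (-((i : ℕ) : ℤ)) = ∑ i : Fin m, f (i : ℕ) := by
  have : NeZero m := ⟨hm.ne'⟩
  rw [← Equiv.sum_comp (Equiv.neg (Fin m))]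
  refine Finset.sum_congr rfl fun i _ => hf _ _ ?_
  rw [Equiv.neg_apply, Fin.val_neg']
  push_cast [Int.natCast_sub i.2.le]
  have h := Int.mod_modEq ((m : ℤ) - (i : ℕ)) m
  have h2 := h.neg
  refine h2.trans ?_
  rw [Int.modEq_iff_dvd]
  exact ⟨1, by ring⟩

/-- The index changes sign because circulants use powers of x ↦ x^{[k]}, while `coef` uses powers of
its inverse σ. -/
theorem isMatrixOf_iff_coef {k : ℕ} (hk : Nat.Coprime k (Module.finrank K F))
    (b : Fin (Module.finrank K F) → F) (B : F ≃ₗ[K] F) :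
    IsMatrixOf K k b B ↔ ∀ j, b j = coef hk (-((j : ℕ) : ℤ)) B.toLinearMap := by
  have hpos : 0 < Module.finrank K F := Module.finrank_pos
  have hposz : 0 < (Module.finrank K F : ℤ) := by exact_mod_cast hpos
  have hfr : ∀ (j : ℕ) (x : F), fr K ((k : ℤ) * j) x = frobMap K F F k (-(j : ℤ)) x := by
    intro j x
    rw [frobMap_self_apply, neg_mul_neg]
  rw [isMatrixOf_iff_forall_sum]
  constructor
  · intro h
    have hlt : ∀ i : ℤ, (-i % Module.finrank K F).toNat < Module.finrank K F := fun i => by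
      have h1 := Int.emod_lt_of_pos (-i) hposz
      omega
    let c : ℤ → F := fun i => b ⟨(-i % Module.finrank K F).toNat, hlt i⟩
    have hcper : ∀ i j : ℤ, i ≡ j [ZMOD Module.finrank K F] → c i = c j := by
      intro i j hij
      have : -i % (Module.finrank K F : ℤ) = -j % (Module.finrank K F : ℤ) := hij.neg
      simp only [c, this]
    have hc : ∀ j : Fin (Module.finrank K F), c (-((j : ℕ) : ℤ)) = b j := by
      intro j
      refine congrArg b (Fin.ext ?_)
      simp only [neg_neg]
      rw [Int.emod_eq_of_lt (by omega) (by have := j.2; omega), Int.toNat_natCast]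
    have hcoef := coef_eq_of_sum hk (φ := B.toLinearMap) hcper (fun x => by
      rw [← sum_neg_of_periodic hpos (fun i => c i * frobMap K F F k i x)
        (fun i j hij => by simp only [hcper i j hij, frobMap_congr K hij])]
      rw [LinearEquiv.coe_coe, h]
      refine Finset.sum_congr rfl fun j _ => ?_
      rw [hc, hfr])
    intro j
    rw [hcoef, hc]
  · intro h x
    have := eq_sum_coef hk B.toLinearMap x
    rw [← sum_neg_of_periodic hpos (fun i => coef hk i B.toLinearMap * frobMap K F F k i x)
        (fun i j hij => by simp only [coef_congr hk hij, frobMap_congr K hij])] at this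
    rw [LinearEquiv.coe_coe] at this
    rw [this]
    refine Finset.sum_congr rfl fun j _ => ?_
    rw [h, hfr]

end Circulant

/-! ### The big group consists of triples -/

section BigGroup

theorem coprime_finrank {K L M : Type*} [Field K] [Field L] [Field M] [Algebra K L]
    [Algebra K M] [Algebra L M] [IsScalarTower K L M] {k : ℕ}
    (hkM : Nat.Coprime k (Module.finrank K M)) : Nat.Coprime k (Module.finrank K L) :=
  hkM.coprime_dvd_right ⟨_, (Module.finrank_mul_finrank K L M).symm⟩

theorem IsTriple.mem_bigGroup {K L M : Type*} [Field K] [Fintype K] [Field L] [Finite L]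
    [Field M] [Finite M] [Algebra K L] [Algebra K M] {k : ℕ} (p : ℕ) [Fact p.Prime] [CharP K p]
    [CharP L p] [CharP M p] {τ : Equiv.Perm (Forms K L M)} {a : L}
    {b : Fin (Module.finrank K M) → M} {i : ℤ} {e : ℕ} (h : IsTriple p k τ a b i e) :
    τ ∈ bigGroup K L M p k := by
  obtain ⟨hb, A, B, hA, hB, rfl⟩ := h
  have hpull : pull A B = pull A (LinearEquiv.refl K M) * pull (LinearEquiv.refl K L) B := rfl
  rw [hpull]
  refine mul_mem (mul_mem (mul_mem ?_ ?_) (pow_mem ?_ e)) (zpow_mem ?_ i)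
  · exact Subgroup.subset_closure (Or.inl (Or.inl (Or.inl ⟨a, A, hA, rfl⟩)))
  · exact Subgroup.subset_closure (Or.inl (Or.inl (Or.inr ⟨b, B, hb, hB, rfl⟩)))
  · exact Subgroup.subset_closure (Or.inr rfl)
  · exact Subgroup.subset_closure (Or.inl (Or.inr rfl))

variable {K L M : Type*} [Field K] [Fintype K] [Field L] [Finite L] [Field M] [Finite M]
  [Algebra K L] [Algebra K M] [Algebra L M] [IsScalarTower K L M]
  {k : ℕ}

theorem fr_algebraMap_of_dvd {j : ℤ} (hj : (Module.finrank K L : ℤ) ∣ j) (x : L) :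
    fr K j (algebraMap L M x) = algebraMap L M x := by
  rw [← fr_algebraMap, (fr_eq_iff K (F := L) j 0).mpr (Int.modEq_zero_iff_dvd.mpr hj), fr_zero]

/-- Coefficients of a `θ`-semilinear map vanish where `frobMap` differs from `θ`. -/
theorem frobMap_eq_of_coef_ne_zero (hkM : Nat.Coprime k (Module.finrank K M))
    (B : M →ₗ[K] M) (θ : L → L)
    (hB : ∀ (x : L) (y : M), B (x • y) = θ x • B y) {i : ℤ} (hi : coef hkM i B ≠ 0) (x : L) :
    frobMap K L M k i x = algebraMap L M (θ x) := by
  have h1 : B ∘ₗ LinearMap.mulLeft K (algebraMap L M x) =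
      LinearMap.mulLeft K (algebraMap L M (θ x)) ∘ₗ B := by
    refine LinearMap.ext fun y => ?_
    simpa [Algebra.smul_def] using hB x y
  have h2 := congrArg (coef hkM i) h1
  rw [coef_comp_mul, coef_mul_comp, mul_comm] at h2
  have h3 := mul_right_cancel₀ hi h2
  rwa [frobMap_self_apply, ← frobMap_apply'] at h3

/-- The maps whose array is supported on the multiples of `[L : K]` are the `L`-linear ones. -/
theorem supportedOnMultiples_iff (hkM : Nat.Coprime k (Module.finrank K M))
    {b : Fin (Module.finrank K M) → M} {B : M ≃ₗ[K] M}
    (hb : IsMatrixOf K k b B) :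
    SupportedOnMultiples K L b ↔ ∀ (x : L) (y : M), B (x • y) = x • B y := by
  constructor
  · intro h x y
    rw [isMatrixOf_iff_forall_sum] at hb
    rw [hb, hb, Finset.smul_sum]
    refine Finset.sum_congr rfl fun j _ => ?_
    by_cases hj : Module.finrank K L ∣ (j : ℕ)
    · rw [Algebra.smul_def, Algebra.smul_def, map_mul,
        fr_algebraMap_of_dvd (Dvd.dvd.mul_left (by exact_mod_cast hj) _)]
      ring
    · rw [h j hj, zero_mul, zero_mul, smul_zero]
  · intro h j hj
    by_contra hne
    have hbj := (isMatrixOf_iff_coef hkM b B).mp hb j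
    rw [hbj] at hne
    have h1 := frobMap_eq_of_coef_ne_zero hkM B.toLinearMap id h hne
    have h2 : frobMap K L M k (-((j : ℕ) : ℤ)) = frobMap K L M k 0 := by
      refine AlgHom.ext fun x => ?_
      rw [h1, frobMap_apply, mul_zero, fr_zero, id]
    rw [frobMap_eq_iff K (coprime_finrank hkM)] at h2
    rw [Int.modEq_zero_iff_dvd, dvd_neg] at h2
    exact hj (by exact_mod_cast h2)

theorem exists_isMatrixOf (hkM : Nat.Coprime k (Module.finrank K M)) (B : M ≃ₗ[K] M) :
    ∃ b, IsMatrixOf K k b B :=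
  ⟨_, (isMatrixOf_iff_coef hkM _ B).mpr fun _ => rfl⟩

variable (p : ℕ) [Fact p.Prime] [CharP K p] [CharP L p] [CharP M p]

theorem isSemiPullOver_of_mem_bigGroup (hkM : Nat.Coprime k (Module.finrank K M))
    {τ : Equiv.Perm (Forms K L M)}
    (hτ : τ ∈ bigGroup K L M p k) : ∃ θ : L ≃+* L, IsSemiPullOver θ τ := by
  rw [bigGroup] at hτ
  induction hτ using Subgroup.closure_induction with
  | mem τ h =>
    rcases h with ((⟨a, A, hA, rfl⟩ | ⟨b, B, hb, hB, rfl⟩) | rfl) | rfl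
    · rw [isMatrixOf_singleArray_iff] at hA
      refine ⟨1, isSemiPullOver_pull (fun x y => ?_) (fun x y => rfl)⟩
      rw [hA, hA, mul_left_comm]
      rfl
    · have hL := (supportedOnMultiples_iff hkM hB).mp hb
      exact ⟨1, isSemiPullOver_pull (fun x y => rfl) hL⟩
    · exact ⟨_, isSemiPullOver_shift k⟩
    · exact ⟨_, isSemiPullOver_frobForms p⟩
  | one => exact ⟨1, isSemiPullOver_one⟩
  | mul τ υ _ _ hτ hυ =>
    obtain ⟨θ, hθ⟩ := hτ
    obtain ⟨κ, hκ⟩ := hυ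
    exact ⟨_, hθ.mul hκ⟩
  | inv τ _ hτ =>
    obtain ⟨θ, hθ⟩ := hτ
    exact ⟨_, hθ.inv⟩

theorem isTriple_iff (hkM : Nat.Coprime k (Module.finrank K M))
    (τ : Equiv.Perm (Forms K L M)) (a : L) (b : Fin (Module.finrank K M) → M)
    (i : ℤ) (e : ℕ) : IsTriple p k τ a b i e ↔
      ∃ (A : L ≃ₗ[K] L) (B : M ≃ₗ[K] M), (∀ x, A x = a * x) ∧ IsMatrixOf K k b B ∧
        (∀ (x : L) (y : M), B (x • y) = x • B y) ∧
          τ = pull A B * frobForms K L M p ^ e * shift K L M k ^ i := by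
  constructor
  · rintro ⟨hb, A, B, hA, hB, rfl⟩
    exact ⟨A, B, (isMatrixOf_singleArray_iff a A).mp hA, hB,
      (supportedOnMultiples_iff hkM hB).mp hb, rfl⟩
  · rintro ⟨A, B, hA, hB, hL, rfl⟩
    exact ⟨(supportedOnMultiples_iff hkM hB).mpr hL, A, B,
      (isMatrixOf_singleArray_iff a A).mpr hA, hB, rfl⟩

/-- Choose φ^e ℓ^i inducing the same automorphism θ of L; the quotient is then an L-linear pair,
which is the matrix part of the triple. -/
theorem exists_isTriple_of_isSemiPullOver (hkM : Nat.Coprime k (Module.finrank K M))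
    {h : ℕ} (hq : Fintype.card K = p ^ h)
    {θ : L ≃+* L} {τ : Equiv.Perm (Forms K L M)} (hτ : IsSemiPullOver θ τ) :
    ∃ (a : L) (b : Fin (Module.finrank K M) → M) (i e : ℕ),
      i < Module.finrank K L ∧ e < h ∧ IsTriple p k τ a b i e := by
  have hh : 0 < h := by
    rcases Nat.eq_zero_or_pos h with rfl | h0
    · have := Fintype.one_lt_card (α := K)
      rw [hq, pow_zero] at this
      omega
    · exact h0
  obtain ⟨i, e, hi, he, hθ⟩ := exists_exponents (K := K) (L := L) p hq hh Module.finrank_pos rfl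
    (coprime_finrank hkM) θ
  have h1 : IsSemiPullOver θ (frobForms K L M p ^ e * shift K L M k ^ i) := by
    rw [hθ]
    exact ((isSemiPullOver_frobForms p).pow e).mul ((isSemiPullOver_shift k).pow i)
  have h2 := hτ.mul h1.inv
  rw [inv_mul_cancel] at h2
  obtain ⟨A, B, hAB, hA, hB⟩ := h2.exists_eq_pull
  obtain ⟨b, hb⟩ := exists_isMatrixOf hkM B
  refine ⟨A 1, b, i, e, hi, he, (isTriple_iff p hkM _ _ _ _ _).mpr ⟨A, B, hA, hb, hB, ?_⟩⟩
  rw [← hAB, mul_assoc, zpow_natCast, inv_mul_cancel_right]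

theorem mem_bigGroup_iff (hkM : Nat.Coprime k (Module.finrank K M))
    {h : ℕ} (hq : Fintype.card K = p ^ h) (τ : Equiv.Perm (Forms K L M)) :
    τ ∈ bigGroup K L M p k ↔ ∃ (a : L) (b : Fin (Module.finrank K M) → M) (i e : ℕ),
      i < Module.finrank K L ∧ e < h ∧ IsTriple p k τ a b i e := by
  constructor
  · intro hτ
    obtain ⟨θ, hθ⟩ := isSemiPullOver_of_mem_bigGroup p hkM hτ
    exact exists_isTriple_of_isSemiPullOver p hkM hq hθ
  · rintro ⟨a, b, i, e, -, -, h⟩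
    exact h.mem_bigGroup p

theorem mem_bigGroup_of_isSemiPullOver (hkM : Nat.Coprime k (Module.finrank K M))
    {h : ℕ} (hq : Fintype.card K = p ^ h) {θ : L ≃+* L}
    {τ : Equiv.Perm (Forms K L M)} (hτ : IsSemiPullOver θ τ) : τ ∈ bigGroup K L M p k :=
  (mem_bigGroup_iff p hkM hq τ).mpr (exists_isTriple_of_isSemiPullOver p hkM hq hτ)

end BigGroup

/-! ### Action of pairs, shifts and Frobenius on coefficients -/

section Actions

theorem adjoint_smul {K L M : Type*} [Field K] [Fintype K] [Field L] [Field M] [Finite M]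
    [Algebra K M] [Algebra L M] {B G : M →ₗ[K] M}
    (hG : ∀ y x, Algebra.trace K M (y * B x) = Algebra.trace K M (G y * x))
    (hB : ∀ (x : L) (y : M), B (x • y) = x • B y) (x : L) (y : M) :
    G (algebraMap L M x * y) = algebraMap L M x * G y := by
  rw [← sub_eq_zero]
  refine eq_zero_of_trace_mul (K := K) fun z => ?_
  have e1 := hG y (x • z)
  have e2 := hG (algebraMap L M x * y) z
  rw [hB, Algebra.smul_def, Algebra.smul_def] at e1
  rw [sub_mul, map_sub, ← e2, sub_eq_zero, mul_assoc (algebraMap L M x) (G y),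
    mul_left_comm (algebraMap L M x) (G y), ← e1]
  congr 1
  ring

theorem pull_toForm {K L M : Type*} [Field K] [Fintype K] [Field L] [Field M] [Finite M]
    [Algebra K L] [Algebra K M] {A : L ≃ₗ[K] L} {B : M ≃ₗ[K] M} {G : M →ₗ[K] M}
    (hG : ∀ y x, Algebra.trace K M (y * B x) = Algebra.trace K M (G y * x)) (φ : L →ₗ[K] M) :
    pull A B (toForm K L M φ) = toForm K L M (G ∘ₗ φ ∘ₗ A.toLinearMap) := by
  refine LinearMap.ext fun x => LinearMap.ext fun y => ?_
  rw [pull_apply, toForm_apply, toForm_apply, hG]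
  rfl

theorem shift_zpow {K L M : Type*} [Field K] [Fintype K] [Field L] [Finite L] [Field M]
    [Finite M] [Algebra K L] [Algebra K M] {k : ℕ} (i : ℤ) :
    shift K L M k ^ i = pull (fr K (-(k : ℤ) * i) : L ≃ₐ[K] L).toLinearEquiv
      (fr K (-(k : ℤ) * i) : M ≃ₐ[K] M).toLinearEquiv := by
  have hmul : ∀ i j : ℤ, pull (fr K i : L ≃ₐ[K] L).toLinearEquiv
      (fr K i : M ≃ₐ[K] M).toLinearEquiv * pull (fr K j : L ≃ₐ[K] L).toLinearEquiv
      (fr K j : M ≃ₐ[K] M).toLinearEquiv = pull (fr K (j + i) : L ≃ₐ[K] L).toLinearEquiv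
      (fr K (j + i) : M ≃ₐ[K] M).toLinearEquiv := by
    intro i j
    refine Equiv.ext fun f => LinearMap.ext fun x => LinearMap.ext fun y => ?_
    rw [Equiv.Perm.mul_apply, pull_apply, pull_apply, pull_apply]
    simp only [AlgEquiv.toLinearEquiv_apply, fr_add]
  have hone : pull (fr K 0 : L ≃ₐ[K] L).toLinearEquiv (fr K 0 : M ≃ₐ[K] M).toLinearEquiv = 1 := by
    refine Equiv.ext fun f => LinearMap.ext fun x => LinearMap.ext fun y => ?_
    rw [pull_apply]
    simp only [AlgEquiv.toLinearEquiv_apply, fr_zero, Equiv.Perm.one_apply]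
  induction i using Int.induction_on with
  | zero => rw [mul_zero, hone, zpow_zero]
  | succ i ih =>
    rw [zpow_add_one, ih, shift, hmul]
    congr 3 <;> ring
  | pred i ih =>
    rw [zpow_sub_one, ih, mul_inv_eq_iff_eq_mul, shift, hmul]
    congr 3 <;> ring

variable {K L M : Type*} [Field K] [Fintype K] [Field L] [Finite L] [Field M] [Finite M]
  [Algebra K L] [Algebra K M] [Algebra L M] [IsScalarTower K L M] {k : ℕ}

/-- The adjoint with respect to the trace form. -/
theorem exists_adjoint (hkM : Nat.Coprime k (Module.finrank K M)) (B : M →ₗ[K] M) :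
    ∃ G : M →ₗ[K] M,
      (∀ y x, Algebra.trace K M (y * B x) = Algebra.trace K M (G y * x)) ∧
        ∀ j, coef hkM j G = fr K (-(k : ℤ) * j) (coef hkM (-j) B) := by
  let c : ℤ → M := fun j => fr K (-(k : ℤ) * j) (coef hkM (-j) B)
  have hc : ∀ i j : ℤ, i ≡ j [ZMOD Module.finrank K M] → c i = c j := by
    intro i j hij
    simp only [c, coef_congr hkM hij.neg, (fr_eq_iff K (F := M) _ _).mpr (hij.mul_left (-(k : ℤ)))]
  let G : M →ₗ[K] M := sumFrob K M M k fun j => c (j : ℕ)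
  have hG : ∀ y, G y = ∑ j : Fin (Module.finrank K M), c (j : ℕ) * frobMap K M M k (j : ℕ) y :=
    fun y => sumFrob_apply K k _ y
  refine ⟨G, fun y x => ?_, fun j => coef_eq_of_sum hkM hc hG j⟩
  have hB := eq_sum_coef hkM B x
  rw [← sum_neg_of_periodic Module.finrank_pos (fun i => coef hkM i B * frobMap K M M k i x)
    (fun i j hij => by simp only [coef_congr hkM hij, frobMap_congr K hij])] at hB
  rw [hB, hG, Finset.mul_sum, Finset.sum_mul, map_sum, map_sum]
  refine Finset.sum_congr rfl fun j _ => ?_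
  rw [← trace_fr (-(k : ℤ) * (j : ℕ))]
  simp only [map_mul, frobMap_self_apply, ← fr_add, c]
  rw [show -(k : ℤ) * (j : ℕ) + -(k : ℤ) * -((j : ℕ) : ℤ) = 0 by ring, fr_zero]
  congr 1
  ring

theorem shift_zpow_toForm (hk : Nat.Coprime k (Module.finrank K L)) (i : ℤ) (φ : L →ₗ[K] M) :
    ∃ ψ, (shift K L M k ^ i) (toForm K L M φ) = toForm K L M ψ ∧
      ∀ v, coef hk v ψ = fr K ((k : ℤ) * i) (coef hk v φ) := by
  refine ⟨(fr K (-(k : ℤ) * -i) : M ≃ₐ[K] M).toLinearMap ∘ₗ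
    φ ∘ₗ (fr K (-(k : ℤ) * i) : L ≃ₐ[K] L).toLinearMap, ?_, fun v => ?_⟩
  · refine LinearMap.ext fun x => LinearMap.ext fun y => ?_
    rw [shift_zpow, pull_apply, toForm_apply, toForm_apply, ← trace_fr (-(k : ℤ) * -i)]
    simp only [map_mul, LinearMap.comp_apply, AlgEquiv.toLinearEquiv_apply,
      AlgEquiv.toLinearMap_apply, ← fr_add]
    rw [show -(k : ℤ) * -i + -(k : ℤ) * i = 0 by ring, fr_zero]
  · rw [coef_fr, coef_comp_fr, neg_mul_neg, sub_neg_eq_add, add_sub_cancel_right]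

variable (p : ℕ) [Fact p.Prime] [CharP K p] [CharP L p] [CharP M p]

theorem trace_frobenius (x : M) :
    Algebra.trace K M (x ^ p) = Algebra.trace K M x ^ p := by
  have h := Algebra.trace_eq_of_equiv_equiv (frobeniusEquiv K p) (frobeniusEquiv M p) (by
    ext c
    simp [frobenius_def]) x
  rw [h, ← frobenius_def, ← frobenius_def, ← frobeniusEquiv_apply, ← frobeniusEquiv_apply,
    RingEquiv.apply_symm_apply]

/-- The p-th power map commutes with the trace and with σ, so it only affects the coefficients. -/
theorem frobForms_toForm (hk : Nat.Coprime k (Module.finrank K L)) (φ : L →ₗ[K] M) :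
    ∃ ψ, frobForms K L M p (toForm K L M φ) = toForm K L M ψ ∧
      ∀ v, coef hk v ψ = coef hk v φ ^ p := by
  let c : ℤ → M := fun v => coef hk v φ ^ p
  have hψ : ∀ x, sumFrob K L M k (fun i => c (i : ℕ)) x =
      ∑ i : Fin (Module.finrank K L), c (i : ℕ) * frobMap K L M k (i : ℕ) x :=
    fun x => sumFrob_apply K k _ x
  refine ⟨sumFrob K L M k fun i => c (i : ℕ), ?_, coef_eq_of_sum hk
    (fun i j hij => by simp only [coef_congr hk hij]) hψ⟩
  refine LinearMap.ext fun x => LinearMap.ext fun y => ?_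
  obtain ⟨x, rfl⟩ := (frobeniusEquiv L p).surjective x
  obtain ⟨y, rfl⟩ := (frobeniusEquiv M p).surjective y
  rw [frobForms_apply, toForm_apply, toForm_apply, RingEquiv.symm_apply_apply,
    RingEquiv.symm_apply_apply, hψ, frobeniusEquiv_apply, frobenius_def, ← trace_frobenius,
    mul_pow, eq_sum_coef hk φ, ← frobenius_def, map_sum]
  simp only [c, frobeniusEquiv_apply, frobenius_def, mul_pow, map_pow]

theorem frobForms_pow_toForm (hk : Nat.Coprime k (Module.finrank K L)) (e : ℕ) (φ : L →ₗ[K] M) :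
    ∃ ψ, (frobForms K L M p ^ e) (toForm K L M φ) = toForm K L M ψ ∧
      ∀ v, coef hk v ψ = coef hk v φ ^ p ^ e := by
  induction e with
  | zero => exact ⟨φ, by simp, by simp⟩
  | succ e ih =>
    obtain ⟨ψ, hψ, hc⟩ := ih
    obtain ⟨χ, hχ, hd⟩ := frobForms_toForm p hk ψ
    refine ⟨χ, ?_, fun v => ?_⟩
    · rw [pow_succ', Equiv.Perm.mul_apply, hψ, hχ]
    · rw [hd, hc, ← pow_mul, pow_succ]

end Actions

/-! ### When a triple preserves the code -/

section Triples

/-- The space of forms is finite and τ is injective, so mapping X into itself already means mapping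
it onto itself. -/
theorem mem_codeAut_iff {K L M : Type*} [Field K] [Fintype K] [Field L] [Finite L] [Field M]
    [Finite M] [Algebra K L] [Algebra K M] {X : Submodule K (Forms K L M)} {τ : Equiv.Perm (Forms K L M)}
    (hτ : τ ∈ rankAut K L M) :
    τ ∈ codeAut (X : Set (Forms K L M)) ↔ ∀ f ∈ X, τ f ∈ X := by
  have hfin : Finite (Forms K L M) := Module.finite_of_finite K
  constructor
  · rintro ⟨-, h⟩ f hf
    have : τ f ∈ τ '' (X : Set (Forms K L M)) := ⟨f, hf, rfl⟩
    rw [h] at this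
    exact this
  · intro h
    refine ⟨hτ, Set.eq_of_subset_of_ncard_le ?_ ?_ (Set.toFinite _)⟩
    · rintro _ ⟨f, hf, rfl⟩
      exact h f hf
    · rw [Set.ncard_image_of_injective _ τ.injective]

theorem fr_pow_injective {K M : Type*} [Field K] [Fintype K] [Field M] [Finite M] [Algebra K M]
    (p : ℕ) [Fact p.Prime] [CharP M p] (i : ℤ) (e : ℕ) :
    Function.Injective fun c : M => fr K i c ^ p ^ e := by
  intro c d h
  have h2 : (frobeniusEquiv M p ^ e) (fr K i c) = (frobeniusEquiv M p ^ e) (fr K i d) := by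
    rw [frobeniusEquiv_pow_apply, frobeniusEquiv_pow_apply]
    exact h
  exact (fr K i : M ≃ₐ[K] M).injective ((frobeniusEquiv M p ^ e).injective h2)

variable {K L M : Type*} [Field K] [Fintype K] [Field L] [Finite L] [Field M] [Finite M]
  [Algebra K L] [Algebra K M] [Algebra L M] [IsScalarTower K L M] {k : ℕ}

/-- The values σ^v(x) lie in L, so an L-linear G passes through them and does not mix coefficients.
-/
theorem coef_comp_of_smul (hk : Nat.Coprime k (Module.finrank K L)) {G : M →ₗ[K] M}
    {A : L →ₗ[K] L} {a : L} (hA : ∀ x, A x = a * x)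
    (hG : ∀ (x : L) (y : M), G (algebraMap L M x * y) = algebraMap L M x * G y)
    (φ : L →ₗ[K] M) (v : ℤ) :
    coef hk v (G ∘ₗ φ ∘ₗ A) = frobMap K L M k v a * G (coef hk v φ) := by
  apply coef_eq_of_sum hk (c := fun v => frobMap K L M k v a * G (coef hk v φ))
  · intro i j hij
    simp only [frobMap_congr K hij, coef_congr hk hij]
  · intro x
    rw [LinearMap.comp_apply, LinearMap.comp_apply, hA, eq_sum_coef hk φ, map_sum]
    refine Finset.sum_congr rfl fun i _ => ?_
    rw [mul_comm (coef hk _ φ), frobMap_apply, hG, ← frobMap_apply, map_mul]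
    ring

variable (p : ℕ) [Fact p.Prime] [CharP K p] [CharP L p] [CharP M p]

/-- A triple is an automorphism of the code if and only if an identity between linear maps
holds. -/
theorem triple_mem_codeAut_iff_forall (hkM : Nat.Coprime k (Module.finrank K M))
    {t : ℕ} (ht1 : 1 ≤ t) (ht : t < Module.finrank K L) {s : ℤ} {μ : M} {a : L}
    {A : L ≃ₗ[K] L} {B : M ≃ₗ[K] M} (hA : ∀ x, A x = a * x)
    (hB : ∀ (x : L) (y : M), B (x • y) = x • B y) (i : ℤ) (e : ℕ) {G : M →ₗ[K] M}
    (hG : ∀ y x, Algebra.trace K M (y * B x) = Algebra.trace K M (G y * x)) :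
    pull A B * frobForms K L M p ^ e * shift K L M k ^ i ∈
        codeAut (puncturedCode K L M k t μ s : Set (Forms K L M)) ↔
      ∀ c, frobMap K L M k t a * G (fr K ((k : ℤ) * i) (fr K (-(k : ℤ) * t) μ) ^ p ^ e *
          fr K (-(k : ℤ) * (t - s)) c) =
        fr K (-(k : ℤ) * t) μ * fr K (-(k : ℤ) * (t - s)) (algebraMap L M a * G c) := by
  have hk : Nat.Coprime k (Module.finrank K L) := coprime_finrank hkM
  set η := fr K (-(k : ℤ) * t) μ with hη
  have hrank : pull A B * frobForms K L M p ^ e * shift K L M k ^ i ∈ rankAut K L M := by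
    refine mul_mem (mul_mem (isSemiPull_pull A B).mem_rankAut
      (pow_mem (isSemiPull_frobForms p).mem_rankAut e)) (zpow_mem ?_ i)
    exact (isSemiPull_pull _ _).mem_rankAut
  rw [mem_codeAut_iff hrank]
  have hact : ∀ φ : L →ₗ[K] M, ∃ χ, (pull A B * frobForms K L M p ^ e * shift K L M k ^ i)
      (toForm K L M φ) = toForm K L M χ ∧ ∀ v, coef hk v χ =
        frobMap K L M k v a * G (fr K ((k : ℤ) * i) (coef hk v φ) ^ p ^ e) := by
    intro φ
    obtain ⟨ψ, h1, h2⟩ := shift_zpow_toForm hk i φ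
    obtain ⟨χ, h3, h4⟩ := frobForms_pow_toForm p hk e ψ
    refine ⟨G ∘ₗ χ ∘ₗ A.toLinearMap, ?_, fun v => ?_⟩
    · rw [Equiv.Perm.mul_apply, Equiv.Perm.mul_apply, h1, h3, pull_toForm hG]
    · rw [coef_comp_of_smul hk hA (adjoint_smul hG hB), h4, h2]
  have hcomm : ∀ c : M, fr K ((k : ℤ) * i) (η * fr K (-(k : ℤ) * (t - s)) c) ^ p ^ e =
      fr K ((k : ℤ) * i) η ^ p ^ e *
        fr K (-(k : ℤ) * (t - s)) (fr K ((k : ℤ) * i) c ^ p ^ e) := by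
    intro c
    rw [map_mul, mul_pow]
    congr 1
    rw [map_pow, ← fr_add, ← fr_add, add_comm]
  have h0 : frobMap K L M k 0 a = algebraMap L M a := by
    rw [frobMap_apply, mul_zero, fr_zero]
  constructor
  · intro h c
    -- The identity is wanted for every value of the transformed coefficient; c ↦ (c^{[ki]})^{p^e}
    -- is bijective on the finite field M.
    obtain ⟨c, rfl⟩ := (Finite.injective_iff_surjective.mp
      (fr_pow_injective (K := K) p ((k : ℤ) * i) e)) c
    have hφ := twist_mem_twistedSpace hk ht1 ht (η := η) (u := t - s) c
    set φ := c • (frobMap K L M k 0).toLinearMap +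
      (η * fr K (-(k : ℤ) * (t - s)) c) • (frobMap K L M k t).toLinearMap with hφdef
    have hc0 : coef hk 0 φ = c := by
      rw [hφdef, map_add, coef_smul_frobMap, coef_smul_frobMap, if_pos (Int.ModEq.refl _),
        if_neg (not_modEq_of_lt (by omega) (by omega) (by omega)), add_zero]
    obtain ⟨χ, h1, h2⟩ := hact φ
    have h3 := h _ ((mem_puncturedCode hk ht1 ht μ s φ).mpr hφ)
    rw [h1, mem_puncturedCode hk ht1 ht, mem_twistedSpace] at h3
    have h4 := h3.2
    rw [h2, h2, hφ.2, hc0, h0, hcomm] at h4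
    exact h4
  · intro h f hf
    obtain ⟨φ, rfl⟩ := (toForm K L M).surjective f
    rw [mem_puncturedCode hk ht1 ht] at hf
    obtain ⟨χ, h1, h2⟩ := hact φ
    rw [h1, mem_puncturedCode hk ht1 ht, mem_twistedSpace]
    refine ⟨fun v hv hv' => ?_, ?_⟩
    · rw [h2, hf.1 v hv hv', map_zero, zero_pow (pow_ne_zero _ (Fact.out : p.Prime).ne_zero),
        map_zero, mul_zero]
    · rw [h2, h2, hf.2, hcomm, h, h0]

/-- Both sides of the twist identity are linear in c. Their coefficients at j + (t - s) involve only
b_j, which gives one equation for each j, trivial when b_j = 0. -/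
theorem triple_mem_codeAut_iff (hkM : Nat.Coprime k (Module.finrank K M))
    {t : ℕ} (ht1 : 1 ≤ t) (ht : t < Module.finrank K L) {s : ℤ} {μ : M}
    {τ : Equiv.Perm (Forms K L M)} {a : L} {b : Fin (Module.finrank K M) → M} {i : ℤ} {e : ℕ}
    (hτ : IsTriple p k τ a b i e) :
    τ ∈ codeAut (puncturedCode K L M k t μ s : Set (Forms K L M)) ↔
      ∀ (l : ℕ) (j : Fin (Module.finrank K M)), (j : ℕ) = l * Module.finrank K L → b j ≠ 0 →
        μ * (algebraMap L M (fr K (s * k) a / a)) *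
            fr K (-((k : ℤ) * (l * Module.finrank K L)))
              (fr K (s * k) (b j) / fr K ((t : ℤ) * k) (b j)) =
          fr K ((k : ℤ) * (i - l * Module.finrank K L)) (μ ^ p ^ e) := by
  have hsupp := hτ.1
  obtain ⟨A, B, hA, hb, hB, rfl⟩ := (isTriple_iff p hkM τ a b i e).mp hτ
  have ha : a ≠ 0 := by
    intro ha
    have := hA (A.symm 1)
    rw [LinearEquiv.apply_symm_apply, ha, zero_mul] at this
    exact one_ne_zero this
  have ha' : algebraMap L M a ≠ 0 := (map_ne_zero _).mpr ha
  obtain ⟨G, hG, hGc⟩ := exists_adjoint hkM B.toLinearMap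
  rw [triple_mem_codeAut_iff_forall p hkM ht1 ht hA hB i e hG]
  set η := fr K (-(k : ℤ) * t) μ with hη
  set ω := fr K ((k : ℤ) * i) η ^ p ^ e with hω
  rw [isMatrixOf_iff_coef hkM] at hb
  have hGb : ∀ j : Fin (Module.finrank K M),
      coef hkM (j : ℕ) G = fr K (-(k : ℤ) * (j : ℕ)) (b j) := by
    intro j
    rw [hGc, hb]
  -- the identity in terms of coefficients
  have hcoef : (∀ c, frobMap K L M k t a * G (ω * fr K (-(k : ℤ) * (t - s)) c) =
      η * fr K (-(k : ℤ) * (t - s)) (algebraMap L M a * G c)) ↔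
      ∀ j : Fin (Module.finrank K M),
        frobMap K L M k t a * (coef hkM (j : ℕ) G * fr K (-(k : ℤ) * (j : ℕ)) ω) =
          η * fr K (-(k : ℤ) * (t - s)) (algebraMap L M a * coef hkM (j : ℕ) G) := by
    let X : M →ₗ[K] M := LinearMap.mulLeft K (frobMap K L M k t a) ∘ₗ (G ∘ₗ LinearMap.mulLeft K ω) ∘ₗ
      (fr K (-(k : ℤ) * (t - s)) : M ≃ₐ[K] M).toLinearMap
    let Y : M →ₗ[K] M := LinearMap.mulLeft K η ∘ₗ
      (fr K (-(k : ℤ) * (t - s)) : M ≃ₐ[K] M).toLinearMap ∘ₗ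
        LinearMap.mulLeft K (algebraMap L M a) ∘ₗ G
    have hX : ∀ j, coef hkM (j + (t - s)) X =
        frobMap K L M k t a * (coef hkM j G * fr K (-(k : ℤ) * j) ω) := by
      intro j
      rw [coef_mul_comp, coef_comp_fr, add_sub_cancel_right, coef_comp_mul, frobMap_self_apply]
    have hY : ∀ j, coef hkM (j + (t - s)) Y =
        η * fr K (-(k : ℤ) * (t - s)) (algebraMap L M a * coef hkM j G) := by
      intro j
      rw [coef_mul_comp, coef_fr, add_sub_cancel_right, coef_mul_comp]
    have hXY : (∀ c, frobMap K L M k t a * G (ω * fr K (-(k : ℤ) * (t - s)) c) =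
        η * fr K (-(k : ℤ) * (t - s)) (algebraMap L M a * G c)) ↔ X = Y :=
      ⟨fun h => LinearMap.ext h, fun h c => LinearMap.congr_fun h c⟩
    rw [hXY]
    constructor
    · intro h j
      rw [← hX, ← hY, h]
    · intro h
      refine coef_ext hkM fun v => ?_
      have hposz : 0 < (Module.finrank K M : ℤ) := by exact_mod_cast Module.finrank_pos
      obtain ⟨r, hr⟩ := Int.eq_ofNat_of_zero_le (Int.emod_nonneg (v - (t - s)) hposz.ne')
      have hlt := Int.emod_lt_of_pos (v - (t - s)) hposz
      have hmod : v ≡ r + (t - s) [ZMOD Module.finrank K M] := by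
        rw [← hr]
        have := (Int.mod_modEq (v - (t - s)) (Module.finrank K M)).add_right (t - s)
        rw [sub_add_cancel] at this
        exact this.symm
      rw [coef_congr hkM hmod, coef_congr hkM hmod, hX, hY]
      exact h ⟨r, by omega⟩
  rw [hcoef]
  -- comparison of the equations
  have hωμ : ω = fr K (-(k : ℤ) * t) (fr K ((k : ℤ) * i) (μ ^ p ^ e)) := by
    rw [hω, hη, ← fr_add, ← fr_add, add_comm, map_pow]
  have heq : ∀ j : Fin (Module.finrank K M), b j ≠ 0 →
      ((frobMap K L M k t a * (coef hkM (j : ℕ) G * fr K (-(k : ℤ) * (j : ℕ)) ω) =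
          η * fr K (-(k : ℤ) * (t - s)) (algebraMap L M a * coef hkM (j : ℕ) G)) ↔
        μ * (algebraMap L M (fr K (s * k) a / a)) * fr K (-((k : ℤ) * (j : ℕ)))
            (fr K (s * k) (b j) / fr K ((t : ℤ) * k) (b j)) =
          fr K ((k : ℤ) * (i - (j : ℕ))) (μ ^ p ^ e)) := by
    intro j hj
    -- Applying x ↦ x^{[kt]} turns η back into μ; what remains is to divide by a and by a conjugate
    -- of b_j.
    rw [← (fr K ((k : ℤ) * t) : M ≃ₐ[K] M).injective.eq_iff, hGb, hωμ, hη]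
    simp only [map_mul, map_div₀, frobMap_apply', ← fr_add, fr_algebraMap]
    have e1 : (k : ℤ) * t + -(k : ℤ) * t = 0 := by ring
    have e2 : (k : ℤ) * t + -(k : ℤ) * (j : ℕ) = -((k : ℤ) * (j : ℕ)) + t * k := by ring
    have e3 : (k : ℤ) * t + (-(k : ℤ) * (j : ℕ) + (-(k : ℤ) * t + (k : ℤ) * i)) =
        (k : ℤ) * (i - (j : ℕ)) := by ring
    have e4 : (k : ℤ) * t + -(k : ℤ) * (t - s) = s * k := by ring
    have e5 : (k : ℤ) * t + (-(k : ℤ) * (t - s) + -(k : ℤ) * (j : ℕ)) =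
        -((k : ℤ) * (j : ℕ)) + s * k := by ring
    rw [e1, e2, e3, e4, e5, fr_zero, fr_zero]
    have hz : fr K (-((k : ℤ) * (j : ℕ)) + t * k) (b j) ≠ 0 := (map_ne_zero _).mpr hj
    rw [mul_div_assoc' μ, div_mul_div_comm, div_eq_iff (mul_ne_zero ha' hz)]
    constructor
    · intro h
      linear_combination -h
    · intro h
      linear_combination -h
  constructor
  · intro h l j hjl hj
    have := (heq j hj).mp (h j)
    rw [hjl, Nat.cast_mul] at this
    exact this
  · intro h j
    by_cases hj : b j = 0
    · rw [hGb, hj]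
      simp
    · rw [heq j hj]
      have hdvd : Module.finrank K L ∣ (j : ℕ) := by
        by_contra hnd
        exact hj (hsupp j hnd)
      obtain ⟨l, hl⟩ := hdvd
      rw [mul_comm] at hl
      have := h l j hl hj
      rw [hl, Nat.cast_mul]
      exact this

end Triples

/-! ### The automorphism group of the code lies in the big group -/

section Containment

/-- Maps all of whose nonzero coefficients lie in one residue class are semilinear. -/
theorem smul_of_forall_modEq {K L F : Type*} [Field K] [Fintype K] [Field L] [Finite L] [Field F]
    [Finite F] [Algebra K L] [Algebra K F] [Algebra L F] [IsScalarTower K L F] {k : ℕ}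
    (hk : Nat.Coprime k (Module.finrank K F)) {B : F →ₗ[K] F} {i₀ : ℤ}
    (hB : ∀ i, coef hk i B ≠ 0 → i ≡ i₀ [ZMOD Module.finrank K L]) (x : L) (y : F) :
    B (x • y) = fr K (-(k : ℤ) * i₀) x • B y := by
  rw [eq_sum_coef hk B, eq_sum_coef hk B, Finset.smul_sum]
  refine Finset.sum_congr rfl fun i _ => ?_
  by_cases hi : coef hk (i : ℕ) B = 0
  · rw [hi, zero_mul, zero_mul, smul_zero]
  · have h := frobMap_congr K (L := L) (M := F) (k := k) (hB _ hi)
    have h' := DFunLike.congr_fun h x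
    rw [frobMap_apply', frobMap_apply] at h'
    rw [Algebra.smul_def, Algebra.smul_def, map_mul, frobMap_self_apply, h', mul_left_comm]

theorem exists_coef_ne_zero {K F : Type*} [Field K] [Fintype K] [Field F] [Finite F] [Algebra K F]
    {k : ℕ} (hk : Nat.Coprime k (Module.finrank K F)) (B : F ≃ₗ[K] F) :
    ∃ i, coef hk i B.toLinearMap ≠ 0 := by
  by_contra hcon
  push Not at hcon
  have : B.toLinearMap = 0 := coef_ext hk fun i => by rw [hcon, map_zero]
  have h1 := LinearMap.congr_fun this 1
  exact one_ne_zero (B.map_eq_zero_iff.mp h1)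

variable {K L M : Type*} [Field K] [Fintype K] [Field L] [Finite L] [Field M] [Finite M]
  [Algebra K L] [Algebra K M]
  (p : ℕ) [Fact p.Prime] [CharP K p] [CharP L p] [CharP M p]

/-- Up to a power of the Frobenius automorphism, a rank-preserving semilinear map that does not
interchange the arguments comes from a pair of linear maps. -/
theorem exists_eq_pull_mul_pow (hm : 1 < Module.finrank K L) {τ : Equiv.Perm (Forms K L M)}
    (hτ : τ ∈ rankAut K L M)
    (hmn : Module.finrank K L < Module.finrank K M ∨ NoTransposition τ) :
    ∃ (A : L ≃ₗ[K] L) (B : M ≃ₗ[K] M) (e : ℕ), τ = pull A B * frobForms K L M p ^ e := by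
  rcases hmn with hmn | ⟨σ, g, g', hg, hg', rfl⟩
  · obtain ⟨σ, hσ⟩ := hτ.1.2
    obtain ⟨e, rfl⟩ := exists_eq_frobeniusEquiv_pow (L := K) p σ
    have hφ : IsSemiPull (frobeniusEquiv K p ^ e) (frobForms K L M p ^ e) :=
      (isSemiPull_frobForms p).pow e
    set υ := τ * (frobForms K L M p ^ e)⁻¹ with hυ
    have hυr : υ ∈ rankAut K L M := mul_mem hτ (inv_mem hφ.mem_rankAut)
    have hsmul : ∀ (c : K) (f : Forms K L M), υ (c • f) = c • υ f := by
      intro c f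
      rw [hυ, Equiv.Perm.mul_apply, Equiv.Perm.mul_apply, hφ.inv.map_smul, hσ]
      exact congrArg (· • _) ((frobeniusEquiv K p ^ e).apply_symm_apply c)
    let T : Forms K L M ≃ₗ[K] Forms K L M :=
      { υ with
        map_add' := hυr.1.1
        map_smul' := hsmul }
    obtain ⟨A, B, hAB⟩ := exists_eq_pull_of_rank_preserving hm hmn T hυr.2
    refine ⟨A, B, e, ?_⟩
    rw [← mul_inv_eq_iff_eq_mul, ← hυ]
    refine Equiv.ext fun f => LinearMap.ext fun x => LinearMap.ext fun y => ?_
    exact hAB f x y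
  · obtain ⟨e, rfl⟩ := exists_eq_frobeniusEquiv_pow (L := K) p σ
    have hφ : IsSemiPull (frobeniusEquiv K p ^ e) (frobForms K L M p ^ e) :=
      (isSemiPull_frobForms p).pow e
    have h1 : IsSemiPull (frobeniusEquiv K p ^ e) (semiPull _ g g' hg hg') :=
      ⟨g, g', hg, hg', rfl⟩
    have h2 := h1.mul hφ.inv
    rw [mul_inv_cancel] at h2
    obtain ⟨A, B, hAB⟩ := h2.exists_eq_pull
    exact ⟨A, B, e, mul_inv_eq_iff_eq_mul.mp hAB⟩

theorem codeAut_le_bigGroup [Algebra L M] [IsScalarTower K L M] {h : ℕ}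
    (hq : Fintype.card K = p ^ h) {k : ℕ} (hkM : Nat.Coprime k (Module.finrank K M))
    {t : ℕ} (ht1 : 1 ≤ t) (ht : t + 2 ≤ Module.finrank K L) {s : ℤ}
    (hs0 : ¬ s ≡ 0 [ZMOD Module.finrank K L]) (hs1 : ¬ s ≡ 1 [ZMOD Module.finrank K L])
    (hs1' : ¬ s ≡ -1 [ZMOD Module.finrank K L]) (hs2 : ¬ s ≡ 2 [ZMOD Module.finrank K L])
    (hs2' : ¬ s ≡ -2 [ZMOD Module.finrank K L]) {μ : M} {τ : Equiv.Perm (Forms K L M)}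
    (hτ : τ ∈ codeAut (puncturedCode K L M k t μ s : Set (Forms K L M)))
    (hmn : Module.finrank K L < Module.finrank K M ∨ NoTransposition τ) :
    τ ∈ bigGroup K L M p k := by
  have hk : Nat.Coprime k (Module.finrank K L) := coprime_finrank hkM
  obtain ⟨A, B, e, rfl⟩ := exists_eq_pull_mul_pow p (by omega) hτ.1 hmn
  rw [mem_codeAut_iff hτ.1] at hτ
  obtain ⟨G, hG, hGc⟩ := exists_adjoint hkM B.toLinearMap
  set η := fr K (-(k : ℤ) * t) μ
  have hpe : p ^ e ≠ 0 := pow_ne_zero _ (Fact.out : p.Prime).ne_zero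
  -- The Frobenius part changes the twist η into η^{p^e}, so the linear part maps between two
  -- possibly different twisted spaces.
  have hmap : ∀ ψ ∈ twistedSpace hk t (η ^ p ^ e) (t - s),
      G ∘ₗ ψ ∘ₗ A.toLinearMap ∈ twistedSpace hk t η (t - s) := by
    intro ψ hψ
    obtain ⟨φ, hφ⟩ := (toForm K L M).surjective ((frobForms K L M p ^ e)⁻¹ (toForm K L M ψ))
    have h1 : (frobForms K L M p ^ e) (toForm K L M φ) = toForm K L M ψ := by
      rw [hφ]
      exact (frobForms K L M p ^ e).apply_symm_apply _
    obtain ⟨ψ', h2, h3⟩ := frobForms_pow_toForm p hk e φ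
    obtain rfl : ψ' = ψ := (toForm K L M).injective (h2.symm.trans h1)
    have hφm : φ ∈ twistedSpace hk t η (t - s) := by
      refine ⟨fun v hv hv' => ?_, ?_⟩
      · have := hψ.1 v hv hv'
        rw [h3] at this
        exact (pow_eq_zero_iff hpe).mp this
      · have h4 := hψ.2
        rw [h3, h3, map_pow, ← mul_pow] at h4
        have hinj := fr_pow_injective (K := K) (M := M) p 0 e
        simp only [fr_zero] at hinj
        exact hinj h4
    have h5 := hτ _ ((mem_puncturedCode hk ht1 (by omega) μ s φ).mpr hφm)
    rw [Equiv.Perm.mul_apply, h1, pull_toForm hG, mem_puncturedCode hk ht1 (by omega)] at h5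
    exact h5
  -- Passing to the adjoint negates indices, so opposite supports for A and G mean congruent
  -- supports for A and B: all lie in a single class mod m.
  have hsupp : ∀ i j, coef hk i A.toLinearMap ≠ 0 → coef hkM j B.toLinearMap ≠ 0 →
      i ≡ j [ZMOD Module.finrank K L] := by
    intro i j hi hj
    have hj' : coef hkM (-j) G ≠ 0 := by
      rw [hGc, neg_neg]
      exact (map_ne_zero _).mpr hj
    have := modEq_zero_of_twistedSpace hk hkM ht1 ht hs0 hs1 hs1' hs2 hs2'
      (pow_eq_zero_iff hpe) A.surjective hmap hi hj'
    have := this.add_right j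
    rwa [neg_add_cancel_right, zero_add] at this
  obtain ⟨i₀, hi₀⟩ := exists_coef_ne_zero hk A
  obtain ⟨j₀, hj₀⟩ := exists_coef_ne_zero hkM B
  have hA : ∀ x y : L, A (x * y) = fr K (-(k : ℤ) * i₀) x * A y := fun x y =>
    smul_of_forall_modEq (L := L) hk (B := A.toLinearMap)
      (fun i hi => (hsupp i j₀ hi hj₀).trans (hsupp i₀ j₀ hi₀ hj₀).symm) x y
  have hB : ∀ (x : L) (y : M), B (x • y) = fr K (-(k : ℤ) * i₀) x • B y := fun x y =>
    smul_of_forall_modEq hkM (B := B.toLinearMap)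
      (fun j hj => (hsupp i₀ j hi₀ hj).symm) x y
  have hAB : IsSemiPullOver (fr K (-(k : ℤ) * i₀) : L ≃ₐ[K] L).toRingEquiv (pull A B) :=
    isSemiPullOver_pull hA hB
  exact mul_mem (mem_bigGroup_of_isSemiPullOver p hkM hq hAB)
    (pow_mem (mem_bigGroup_of_isSemiPullOver p hkM hq (isSemiPullOver_frobForms p)) e)

end Containment

end PuncturedCodes

end

open PuncturedCodes in
theorem mainTheorem2
    (K L M : Type*) [Field K] [Fintype K] [Field L] [Finite L] [Field M] [Finite M]
    [Algebra K L] [Algebra K M] [Algebra L M] [IsScalarTower K L M]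
    (p h : ℕ) [Fact p.Prime] [CharP K p] [CharP L p] [CharP M p]
    (hq : Fintype.card K = p ^ h)
    (m n : ℕ) (hm : Module.finrank K L = m) (hn : Module.finrank K M = n) (hm1 : 1 < m)
    (k : ℕ) (hk : Nat.Coprime k n)
    (t : ℕ) (ht1 : 1 ≤ t) (ht2 : t ≤ m - 2)
    (s : ℤ) (hs0 : ¬ s ≡ 0 [ZMOD m]) (hs1 : ¬ s ≡ 1 [ZMOD m]) (hs1' : ¬ s ≡ -1 [ZMOD m])
    (hs2 : ¬ s ≡ 2 [ZMOD m]) (hs2' : ¬ s ≡ -2 [ZMOD m])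
    (μ : M) (hμ : Algebra.norm K μ ≠ (-1) ^ (n * t)) :
    -- the elements of the big group are exactly the triples
    (∀ τ : Equiv.Perm (Forms K L M), τ ∈ bigGroup K L M p k ↔
      ∃ (a : L) (b : Fin (Module.finrank K M) → M) (i e : ℕ),
        i < m ∧ e < h ∧ IsTriple p k τ a b i e) ∧
    -- the automorphism group of the code is contained in the big group
    (∀ τ ∈ codeAut (puncturedCode K L M k t μ s : Set (Forms K L M)),
      (m < n ∨ NoTransposition τ) → τ ∈ bigGroup K L M p k) ∧
    -- a triple is an automorphism of the code if and only if the equations hold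
    (∀ (τ : Equiv.Perm (Forms K L M)) (a : L) (b : Fin (Module.finrank K M) → M) (i : ℤ) (e : ℕ),
      IsTriple p k τ a b i e →
      (τ ∈ codeAut (puncturedCode K L M k t μ s : Set (Forms K L M)) ↔
        ∀ (l : ℕ) (j : Fin (Module.finrank K M)), (j : ℕ) = l * m → b j ≠ 0 →
          μ * (algebraMap L M (fr K (s * k) a / a)) *
              fr K (-((k : ℤ) * (l * m))) (fr K (s * k) (b j) / fr K ((t : ℤ) * k) (b j)) =
            fr K ((k : ℤ) * (i - l * m)) (μ ^ p ^ e))) := by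
  subst hm hn
  have ht : t + 2 ≤ Module.finrank K L := by omega
  refine ⟨fun τ => mem_bigGroup_iff p hk hq τ, fun τ hτ hmn => ?_, fun τ a b i e hτ => ?_⟩
  · exact codeAut_le_bigGroup p hq hk ht1 ht hs0 hs1 hs1' hs2 hs2' hτ hmn
  · exact triple_mem_codeAut_iff p hk ht1 (by omega) hτ
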